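/- **Theorem (Select-aware Compressed Data Structure).** Let a multiset $\mathcal M$ of size $n$ over a totally ordered set be listed by an array $A[0..n-1]$. For a value $x$, let $\mathrm{rank}(x)$ be the number of elements of $\mathcal M$ smaller than $x$, and for $j\in[1..n]$ let $\mathrm{select}(j)$ be the $j$-th smallest element, counted with multiplicity. A *run* is a maximal non-decreasing segment of consecutive positions of $A$. Each run is cut into *blocks*: two neighbouring positions of a run lie in the same block if and only if they hold equal values, or they hold two values which both have multiplicity $1$ in $\mathcal M$ and between which no element of $\mathcal M$ lies (so they are consecutive in the sorted multiset). Let $\rho$ be the number of runs and $\delta$ the number of blocks of $A$. Logarithms are binary. The model is the word RAM with words of $w=\Theta(\log n)$ bits, where $w\ge\kappa\,(\lfloor\log n\rfloor+1)$ for a suitable absolute constant $\kappa$ (with $\log 0$ read as $0$): in unit time it adds, subtracts, multiplies, divides, takes remainders, shifts, performs bitwise Boolean operations, compares words, and reads a word of memory. Each query is answered by a fixed program which uses a constant number of registers and reads the stored bit string (packed into $w$-bit words), but neither modifies it nor reads the array $A$; the values themselves are not stored, and elements are designated by their positions in $A$. Then there are such programs for the two queries, independent of $n$, $w$, $A$ and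 the ordered set, such that every array $A$ as above can be represented by a string of at most $$\delta\log\delta+2n+O(\delta\log\log\delta)+o(n)$$ bits from which - $\mathrm{select}$ is supported in constant time: given $j\in[1..n]$, the program returns a position $p$ with $A[p]=\mathrm{select}(j)$ in time $O(1)$; - $\mathrm{rank}$ is supported in time $O\!\left(\frac{\log\delta}{\log\log\delta}\right)$: given a position $p$, the program returns $\mathrm{rank}(A[p])$ within that time (to be read as $O(1)$ for $\delta\le 2$). The constants hidden in the $O$-terms are absolute, and the term $o(n)$ is a function of $n$ alone, depending only on the constant factor in the upper bound $w=O(\log n)$. (The term $\delta\log\log\delta$ is read as $0$ for $\delta\le 1$.) -/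

import Mathlib

/-! ### Runs, blocks, rank and select of an array listing a multiset -/

section Multisets

variable {α : Type*} [LinearOrder α] {n : ℕ}

/-- The multiplicity of the value `x` in the multiset listed by `A`. -/
def multiplicityIn (A : Fin n → α) (x : α) : ℕ :=
  (Finset.univ.filter fun r : Fin n => A r = x).card

/-- Position `i` starts a run (a maximal sorted block of consecutive positions of `A`): it is the
first position, or its predecessor holds a larger value. -/
def StartsRun (A : Fin n → α) (i : Fin n) : Prop :=
  ∀ p : Fin n, p.val + 1 = i.val → A i < A p

/-- Two neighbouring positions `p, q` of one run belong to the same block: either they hold the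
same value, or they hold two values of multiplicity one that are consecutive in the sorted
multiset. Hence a value of multiplicity at least two is never in one block with other values. -/
def SameBlock (A : Fin n → α) (p q : Fin n) : Prop :=
  A p = A q ∨
    (A p < A q ∧ multiplicityIn A (A p) = 1 ∧ multiplicityIn A (A q) = 1 ∧
      ∀ r : Fin n, ¬ (A p < A r ∧ A r < A q))

/-- Position `i` starts a block: it starts a run, or it is not in the block of its predecessor. -/
def StartsBlock (A : Fin n → α) (i : Fin n) : Prop :=
  StartsRun A i ∨ ∀ p : Fin n, p.val + 1 = i.val → ¬ SameBlock A p i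

open Classical in
/-- The number `ρ` of runs. -/
noncomputable def numRuns (A : Fin n → α) : ℕ :=
  (Finset.univ.filter fun i : Fin n => StartsRun A i).card

open Classical in
/-- The number `δ` of blocks. -/
noncomputable def numBlocks (A : Fin n → α) : ℕ :=
  (Finset.univ.filter fun i : Fin n => StartsBlock A i).card

/-- `rank(x)`: the number of elements of the multiset that are smaller than `x`. -/
def rankIn (A : Fin n → α) (x : α) : ℕ :=
  (Finset.univ.filter fun r : Fin n => A r < x).card

/-- The entry with index `j` (counted from `0`) of the sorted array, that is, the `(j+1)`-th
smallest element of the multiset, counted with multiplicity. -/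
def selectIn (A : Fin n → α) (j : Fin n) : α :=
  A (Tuple.sort A j)

end Multisets

/-! ### The word RAM

A machine with `w`-bit words, a read-only memory holding a bit string packed into words, and
registers; a program is a fixed finite text, so it uses a constant number of registers. -/

namespace WordRAM

/-- Binary instructions on words. -/
inductive BinOp
  | add | sub | mul | div | mod | and | or | xor | shl | shr | lt | eq

/-- Their meaning on `w`-bit words (arithmetic is modulo `2 ^ w`, comparisons return `0` or `1`). -/
def BinOp.eval (w : ℕ) : BinOp → ℕ → ℕ → ℕ
  | .add, a, b => (a + b) % 2 ^ w
  | .sub, a, b => (a + (2 ^ w - b)) % 2 ^ w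
  | .mul, a, b => (a * b) % 2 ^ w
  | .div, a, b => a / b
  | .mod, a, b => a % b
  | .and, a, b => a &&& b
  | .or, a, b => a ||| b
  | .xor, a, b => a ^^^ b
  | .shl, a, b => (a <<< b) % 2 ^ w
  | .shr, a, b => a >>> b
  | .lt, a, b => if a < b then 1 else 0
  | .eq, a, b => if a = b then 1 else 0

/-- Expressions: constants, registers, binary instructions, and loads of a memory word. -/
inductive Expr
  | const (k : ℕ)
  | reg (r : ℕ)
  | bin (o : BinOp) (e₁ e₂ : Expr)
  | load (address : Expr)

/-- Programs. -/
inductive Prog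
  | skip
  | assign (r : ℕ) (e : Expr)
  | seq (c₁ c₂ : Prog)
  | ite (e : Expr) (c₁ c₂ : Prog)
  | while (e : Expr) (c : Prog)

/-- The word with address `a` of a memory that holds the bit string `D`: the bits with indices
`a * w, …, a * w + w - 1`, least significant first; bits beyond the end of `D` are zero. -/
def word (w : ℕ) (D : List Bool) (a : ℕ) : ℕ :=
  Nat.ofBits fun j : Fin w => D.getD (a * w + j.val) false

/-- Contents of the registers. -/
abbrev Regs := ℕ → ℕ

/-- The value of an expression. -/
def Expr.eval (w : ℕ) (D : List Bool) (s : Regs) : Expr → ℕ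
  | .const k => k % 2 ^ w
  | .reg r => s r
  | .bin o e₁ e₂ => o.eval w (e₁.eval w D s) (e₂.eval w D s)
  | .load e => word w D (e.eval w D s)

/-- The number of steps taken to evaluate an expression: one per instruction. -/
def Expr.cost : Expr → ℕ
  | .const _ => 1
  | .reg _ => 1
  | .bin _ e₁ e₂ => e₁.cost + e₂.cost + 1
  | .load e => e.cost + 1

/-- `Runs w D c s s' t`: started with registers `s`, the program `c` halts with registers `s'`
after exactly `t` steps, on the machine with `w`-bit words and memory contents `D`. -/
inductive Runs (w : ℕ) (D : List Bool) : Prog → Regs → Regs → ℕ → Prop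
  | skip (s : Regs) : Runs w D .skip s s 1
  | assign (r : ℕ) (e : Expr) (s : Regs) :
      Runs w D (.assign r e) s (Function.update s r (e.eval w D s)) (e.cost + 1)
  | seq {c₁ c₂ : Prog} {s s₁ s₂ : Regs} {t₁ t₂ : ℕ} (h₁ : Runs w D c₁ s s₁ t₁)
      (h₂ : Runs w D c₂ s₁ s₂ t₂) : Runs w D (.seq c₁ c₂) s s₂ (t₁ + t₂)
  | iteTrue {e : Expr} {c₁ c₂ : Prog} {s s' : Regs} {t : ℕ} (he : e.eval w D s ≠ 0)
      (h : Runs w D c₁ s s' t) : Runs w D (.ite e c₁ c₂) s s' (e.cost + 1 + t)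
  | iteFalse {e : Expr} {c₁ c₂ : Prog} {s s' : Regs} {t : ℕ} (he : e.eval w D s = 0)
      (h : Runs w D c₂ s s' t) : Runs w D (.ite e c₁ c₂) s s' (e.cost + 1 + t)
  | whileDone {e : Expr} {c : Prog} {s : Regs} (he : e.eval w D s = 0) :
      Runs w D (.while e c) s s (e.cost + 1)
  | whileStep {e : Expr} {c : Prog} {s s₁ s₂ : Regs} {t₁ t₂ : ℕ} (he : e.eval w D s ≠ 0)
      (h₁ : Runs w D c s s₁ t₁) (h₂ : Runs w D (.while e c) s₁ s₂ t₂) :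
      Runs w D (.while e c) s s₂ (e.cost + 1 + t₁ + t₂)

/-- Started with `x` in register `0` and zero in every other register, the program halts after
exactly `t` steps with `y` in register `0`. -/
def Answers (w : ℕ) (D : List Bool) (c : Prog) (x y t : ℕ) : Prop :=
  ∃ s' : Regs, Runs w D c (fun r => if r = 0 then x else 0) s' t ∧ s' 0 = y

end WordRAM

/-! `Tuple.sort A` orders positions by value, ties by position. Two neighbouring positions of one
block are adjacent in this order (`SameBlock.sort_symm`): nothing fits between equal values at
positions `i` and `i + 1`, nor between consecutive values that occur once each. So a block is moved
rigidly to an interval of the sorted array, and sorting is described by the block starts in `A`, the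
block starts in the sorted array (two bit vectors, `2n` bits), and a permutation `π = blockPerm A`
of the `δ` blocks, stored explicitly in `δ (⌊log δ⌋ + 1)` bits. `exists_block` packages this
correspondence.

For select, counting ones in the sorted bit vector gives the block `r` of entry `j`; the answer is
the start of block `π r` plus the offset of `j` in its block. For rank, `π` is inverted on the block
of `p`. A block with values of multiplicity one has ranks increasing by one along it, while in any
other block all values are equal; so one key per block, the rank of its first value together with
one flag bit, suffices.

To invert `π`, marked points are spaced about `log δ / log log δ` apart along the cycles, each
storing a pointer `2t` steps back (`Equiv.Perm.exists_marks`, `runs_invert`). The pointers cost `O(δ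
log log δ)` bits plus lower order terms.

All other data are monotone sequences bounded by `2n + 1`: block starts, keys, numbers of marks, and
numbers of ones before each chunk of a bit vector. With `ℓ = ⌊log n⌋ + 1`, they are cut into groups
of `ℓ²` entries, stored relative to the first entry of the group with the width that the group
needs. Groups spanning at least `ℓ⁴` are few because the spans sum to at most `2n + 1`; the others
need `O(log log n)` bits per entry (`length_compact_mul_le`, `length_compactArray_le`). Finally `δ
log log n` is `O(δ log log δ)` when `δ ≥ √n + 2`, and otherwise it is `o(n)` (`mul_fieldBound_le`).
-/

namespace WordRAM

/-! ### Bit fields of a bit string -/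

/-- The number whose binary digits are the `b` entries of `D` from index `a` on, least significant
first. -/
def bitsAt (D : List Bool) (a b : ℕ) : ℕ := Nat.ofBits fun j : Fin b => D.getD (a + j.val) false

theorem testBit_bitsAt (D : List Bool) (a b i : ℕ) :
    (bitsAt D a b).testBit i = (decide (i < b) && D.getD (a + i) false) := by
  unfold bitsAt
  by_cases h : i < b
  · simp [Nat.testBit_ofBits_lt _ i h, h]
  · simp [Nat.testBit_ofBits_ge _ i (not_lt.1 h), h]

theorem bitsAt_lt (D : List Bool) (a b : ℕ) : bitsAt D a b < 2 ^ b := Nat.ofBits_lt_two_pow _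

theorem word_eq_bitsAt (w : ℕ) (D : List Bool) (a : ℕ) : word w D a = bitsAt D (a * w) w := rfl

/-- The bit string `seg` occurs in `D` from index `o` on. -/
def OccursAt (D : List Bool) (o : ℕ) (seg : List Bool) : Prop :=
  o + seg.length ≤ D.length ∧ ∀ i < seg.length, D.getD (o + i) false = seg.getD i false

theorem OccursAt.bitsAt {D : List Bool} {o : ℕ} {seg : List Bool} (h : OccursAt D o seg)
    {a b : ℕ} (hab : a + b ≤ seg.length) : bitsAt D (o + a) b = bitsAt seg a b := by
  apply Nat.eq_of_testBit_eq
  intro i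
  rw [testBit_bitsAt, testBit_bitsAt]
  by_cases hi : i < b
  · rw [add_assoc, h.2 (a + i) (by omega)]
  · simp [hi]

theorem OccursAt.trans {D : List Bool} {o o' : ℕ} {seg seg' : List Bool} (h : OccursAt D o seg)
    (h' : OccursAt seg o' seg') : OccursAt D (o + o') seg' := by
  have := h.1
  have := h'.1
  refine ⟨by omega, fun i hi => ?_⟩
  rw [add_assoc, h.2 _ (by omega), h'.2 i hi]

theorem occursAt_append_left (l₁ l₂ : List Bool) : OccursAt (l₁ ++ l₂) 0 l₁ := by
  refine ⟨by simp, fun i hi => ?_⟩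
  rw [zero_add, List.getD_append _ _ _ _ hi]

theorem occursAt_append_right (l₁ l₂ : List Bool) : OccursAt (l₁ ++ l₂) l₁.length l₂ := by
  refine ⟨by simp, fun i hi => ?_⟩
  rw [List.getD_append_right _ _ _ _ (by omega), Nat.add_sub_cancel_left]

theorem occursAt_flatten (segs : List (List Bool)) (k : ℕ) (hk : k < segs.length) :
    OccursAt segs.flatten (segs.take k).flatten.length segs[k] := by
  have h : segs.flatten = (segs.take k).flatten ++ (segs[k] ++ (segs.drop (k + 1)).flatten) := by
    conv_lhs => rw [← List.take_append_drop k segs, List.drop_eq_getElem_cons hk]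
    rw [List.flatten_append, List.flatten_cons]
  rw [h]
  exact (occursAt_append_right _ _).trans (occursAt_append_left _ _)

/-- An array of `N` fields of `b` bits each. -/
def packed (b N : ℕ) (v : ℕ → ℕ) : List Bool :=
  List.ofFn fun k : Fin (N * b) => (v (k.val / b)).testBit (k.val % b)

@[simp] theorem length_packed (b N : ℕ) (v : ℕ → ℕ) : (packed b N v).length = N * b := by
  simp [packed]

theorem getD_packed {b N : ℕ} (v : ℕ → ℕ) {k : ℕ} (hk : k < N * b) :
    (packed b N v).getD k false = (v (k / b)).testBit (k % b) := by
  rw [List.getD_eq_getElem _ _ (by simpa using hk)]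
  simp [packed]

theorem succ_mul_le_of_lt {i N b : ℕ} (hi : i < N) : i * b + b ≤ N * b := by
  rw [← Nat.succ_mul]; exact Nat.mul_le_mul_right b hi

theorem bitsAt_packed {b N : ℕ} {v : ℕ → ℕ} {i : ℕ} (hi : i < N) (hv : v i < 2 ^ b) :
    bitsAt (packed b N v) (i * b) b = v i := by
  apply Nat.eq_of_testBit_eq
  intro j
  have hb := succ_mul_le_of_lt (b := b) hi
  rw [testBit_bitsAt]
  by_cases hj : j < b
  · rw [getD_packed v (by omega), mul_comm i b, Nat.mul_add_div (by omega), Nat.mul_add_mod,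
      Nat.div_eq_of_lt hj, Nat.mod_eq_of_lt hj]
    simp [hj]
  · rw [Nat.testBit_lt_two_pow (hv.trans_le (Nat.pow_le_pow_right (by norm_num) (not_lt.1 hj)))]
    simp [hj]

theorem OccursAt.bitsAt_packed {D : List Bool} {o b N : ℕ} {v : ℕ → ℕ}
    (h : OccursAt D o (packed b N v)) {i : ℕ} (hi : i < N) (hv : v i < 2 ^ b) :
    WordRAM.bitsAt D (o + i * b) b = v i := by
  rw [h.bitsAt (by simpa using succ_mul_le_of_lt hi), WordRAM.bitsAt_packed hi hv]

/-! ### Expressions that read bit fields -/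

namespace Expr

variable {w : ℕ} {D : List Bool} {s : Regs}

theorem eval_const {k : ℕ} (h : k < 2 ^ w) : (const k).eval w D s = k := Nat.mod_eq_of_lt h

theorem eval_reg {r a : ℕ} (h : s r = a) : (reg r).eval w D s = a := h

theorem eval_add {e₁ e₂ : Expr} {a b : ℕ} (h₁ : e₁.eval w D s = a) (h₂ : e₂.eval w D s = b)
    (h : a + b < 2 ^ w) : (bin .add e₁ e₂).eval w D s = a + b := by
  simp [eval, BinOp.eval, h₁, h₂, Nat.mod_eq_of_lt h]

theorem eval_mul {e₁ e₂ : Expr} {a b : ℕ} (h₁ : e₁.eval w D s = a) (h₂ : e₂.eval w D s = b)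
    (h : a * b < 2 ^ w) : (bin .mul e₁ e₂).eval w D s = a * b := by
  simp [eval, BinOp.eval, h₁, h₂, Nat.mod_eq_of_lt h]

theorem eval_sub {e₁ e₂ : Expr} {a b : ℕ} (h₁ : e₁.eval w D s = a) (h₂ : e₂.eval w D s = b)
    (hba : b ≤ a) (h : a < 2 ^ w) : (bin .sub e₁ e₂).eval w D s = a - b := by
  simp only [eval, BinOp.eval, h₁, h₂]
  rw [show a + (2 ^ w - b) = a - b + 2 ^ w by omega, Nat.add_mod_right, Nat.mod_eq_of_lt (by omega)]

theorem eval_div {e₁ e₂ : Expr} {a b : ℕ} (h₁ : e₁.eval w D s = a) (h₂ : e₂.eval w D s = b) :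
    (bin .div e₁ e₂).eval w D s = a / b := by simp [eval, BinOp.eval, h₁, h₂]

theorem eval_mod {e₁ e₂ : Expr} {a b : ℕ} (h₁ : e₁.eval w D s = a) (h₂ : e₂.eval w D s = b) :
    (bin .mod e₁ e₂).eval w D s = a % b := by simp [eval, BinOp.eval, h₁, h₂]

theorem eval_or {e₁ e₂ : Expr} {a b : ℕ} (h₁ : e₁.eval w D s = a) (h₂ : e₂.eval w D s = b) :
    (bin .or e₁ e₂).eval w D s = a ||| b := by simp [eval, BinOp.eval, h₁, h₂]

theorem eval_shr {e₁ e₂ : Expr} {a b : ℕ} (h₁ : e₁.eval w D s = a) (h₂ : e₂.eval w D s = b) :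
    (bin .shr e₁ e₂).eval w D s = a >>> b := by simp [eval, BinOp.eval, h₁, h₂]

theorem eval_shl {e₁ e₂ : Expr} {a b : ℕ} (h₁ : e₁.eval w D s = a) (h₂ : e₂.eval w D s = b) :
    (bin .shl e₁ e₂).eval w D s = (a <<< b) % 2 ^ w := by simp [eval, BinOp.eval, h₁, h₂]

theorem eval_load {e : Expr} {a : ℕ} (h : e.eval w D s = a) :
    (load e).eval w D s = word w D a := by simp [eval, h]

theorem eval_eq {e₁ e₂ : Expr} {a b : ℕ} (h₁ : e₁.eval w D s = a) (h₂ : e₂.eval w D s = b) :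
    (bin .eq e₁ e₂).eval w D s = if a = b then 1 else 0 := by simp [eval, BinOp.eval, h₁, h₂]

/-- The header word with index `k`. -/
def header (k : ℕ) : Expr := load (const k)

/-- The word size, which is stored in the header word `0`. -/
def wordSize : Expr := header 0

/-- The field of `b` bits that starts at the bit index `a`. -/
def field (a b : Expr) : Expr :=
  bin .mod
    (bin .or (bin .shr (load (bin .div a wordSize)) (bin .mod a wordSize))
      (bin .shl (load (bin .add (bin .div a wordSize) (const 1)))
        (bin .sub wordSize (bin .mod a wordSize))))
    (bin .shl (const 1) b)

theorem eval_header {k : ℕ} (h : k < 2 ^ w) :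
    (header k).eval w D s = word w D k := by
  simp [header, eval, Nat.mod_eq_of_lt h]

/-- A field of at most `w` bits meets at most two consecutive words, whose parts are shifted into
place and joined by `or`. If the field starts at a word boundary, the second word is shifted by `w`
and vanishes modulo `2 ^ w`. -/
theorem eval_field (hw : 2 ≤ w) (hW : word w D 0 = w) {a b : Expr} {x y : ℕ}
    (ha : a.eval w D s = x) (hb : b.eval w D s = y) (hx : x < 2 ^ w) (hy : y ≤ w) :
    (field a b).eval w D s = bitsAt D x y := by
  have hw2 : w < 2 ^ w := Nat.lt_two_pow_self
  have hWs : wordSize.eval w D s = w := by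
    rw [wordSize, eval_header (by omega), hW]
  have hq : x / w + 1 < 2 ^ w := by
    have h1 : x / w ≤ x / 2 := Nat.div_le_div_left hw (by norm_num)
    omega
  have hs : x % w < w := Nat.mod_lt _ (by omega)
  have e1 := eval_div ha hWs
  have e2 := eval_mod ha hWs
  have e3 := eval_add e1 (eval_const (D := D) (s := s) (show 1 < 2 ^ w by omega)) hq
  have e4 := eval_sub hWs e2 hs.le hw2
  have hx' : x / w * w + x % w = x := by rw [mul_comm]; exact Nat.div_add_mod x w
  have key : (word w D (x / w) >>> (x % w) ||| (word w D (x / w + 1) <<< (w - x % w)) % 2 ^ w)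
      = bitsAt D x w := by
    apply Nat.eq_of_testBit_eq
    intro i
    rw [Nat.testBit_or, Nat.testBit_shiftRight, Nat.testBit_mod_two_pow, Nat.testBit_shiftLeft,
      word_eq_bitsAt, word_eq_bitsAt, testBit_bitsAt, testBit_bitsAt, testBit_bitsAt, Nat.succ_mul,
      ← add_assoc, hx']
    -- Bit `i` comes from the first word exactly when this holds, otherwise from the second.
    by_cases h1 : x % w + i < w
    · have h2 : i < w := by omega
      have h3 : ¬ (i ≥ w - x % w) := by omega
      simp [h1, h2, h3]
    · by_cases h2 : i < w
      · have h3 : i ≥ w - x % w := by omega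
        have h4 : i - (w - x % w) < w := by omega
        have h5 : x / w * w + w + (i - (w - x % w)) = x + i := by omega
        simp [h1, h2, h3, h4, h5]
      · simp [h1, h2]
  have e5 : (field a b).eval w D s
      = (word w D (x / w) >>> (x % w) ||| (word w D (x / w + 1) <<< (w - x % w)) % 2 ^ w)
        % ((1 <<< y) % 2 ^ w) := by
    exact eval_mod (eval_or (eval_shr (eval_load e1) e2) (eval_shl (eval_load e3) e4))
      (eval_shl (eval_const (by omega)) hb)
  rw [e5, key, Nat.one_shiftLeft]
  -- For a full word the modulus `2 ^ w` overflows to `0`, and reduction modulo `0` changes nothing,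
  -- as desired.
  rcases hy.eq_or_lt with rfl | hy
  · rw [Nat.mod_self, Nat.mod_zero]
  · rw [Nat.mod_eq_of_lt (Nat.pow_lt_pow_right (by norm_num) hy)]
    apply Nat.eq_of_testBit_eq
    intro i
    rw [Nat.testBit_mod_two_pow, testBit_bitsAt, testBit_bitsAt]
    by_cases hi : i < y
    · simp [hi, hi.trans hy]
    · simp [hi]

/-- The field with index `i` of an array of `b`-bit fields that starts at the bit index `o`. -/
def entry (o i b : Expr) : Expr := field (bin .add o (bin .mul i b)) b

theorem eval_entry (hw : 2 ≤ w) (hW : word w D 0 = w) {o i b : Expr} {x k y N : ℕ} {v : ℕ → ℕ}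
    (ho : o.eval w D s = x) (hi : i.eval w D s = k) (hb : b.eval w D s = y)
    (hD : D.length < 2 ^ w) (h : OccursAt D x (packed y N v)) (hk : k < N) (hv : v k < 2 ^ y)
    (hy : y ≤ w) : (entry o i b).eval w D s = v k := by
  have h1 := h.1
  rw [length_packed] at h1
  have h2 := succ_mul_le_of_lt (b := y) hk
  rw [entry, eval_field hw hW (eval_add ho (eval_mul hi hb (by omega)) (by omega)) hb (by omega) hy,
    h.bitsAt_packed hk hv]

end Expr
/-! ### Compact arrays of monotone sequences -/

/-- The width of the fields that hold the entries of the `g`-th group of `L` entries of a monotone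
sequence, relative to the first one. -/
def groupWidth (a : ℕ → ℕ) (L g : ℕ) : ℕ := Nat.size (a ((g + 1) * L) - a (g * L))

/-- The total length of the first `g` groups of fields. -/
def groupsLength (a : ℕ → ℕ) (L g : ℕ) : ℕ := ∑ i ∈ Finset.range g, L * groupWidth a L i

/-- The entries of the `g`-th group. -/
def groupFields (a : ℕ → ℕ) (L g : ℕ) : List Bool :=
  packed (groupWidth a L g) L fun k => a (g * L + k) - a (g * L)

/-- The directory: for each group its first entry, its width and its relative address. -/
def groupDirectory (w : ℕ) (a : ℕ → ℕ) (L G k : ℕ) : ℕ :=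
  if k % 3 = 0 then a (k / 3 * L) else if k % 3 = 1 then groupWidth a L (k / 3)
  else G * 3 * w + groupsLength a L (k / 3)

/-- A representation of the first `G * L` entries of a monotone sequence. -/
def compact (w : ℕ) (a : ℕ → ℕ) (L G : ℕ) : List Bool :=
  packed w (G * 3) (groupDirectory w a L G) ++ ((List.range G).map (groupFields a L)).flatten

theorem length_groups (a : ℕ → ℕ) (L g : ℕ) :
    ((List.range g).map (groupFields a L)).flatten.length = groupsLength a L g := by
  induction g with
  | zero => rfl
  | succ g ih =>
    rw [List.range_succ, List.map_append, List.flatten_append, List.length_append, ih,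
      groupsLength, groupsLength, Finset.sum_range_succ]
    simp [groupFields]

theorem length_compact (w : ℕ) (a : ℕ → ℕ) (L G : ℕ) :
    (compact w a L G).length = G * 3 * w + groupsLength a L G := by
  rw [compact, List.length_append, length_groups, length_packed]

theorem compact_occursAt_groupFields (w : ℕ) (a : ℕ → ℕ) {L G g : ℕ} (hg : g < G) :
    OccursAt (compact w a L G) (G * 3 * w + groupsLength a L g) (groupFields a L g) := by
  have h := occursAt_flatten ((List.range G).map (groupFields a L)) g (by simpa using hg)
  rw [← List.map_take, List.take_range, min_eq_left hg.le, length_groups] at h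
  have h' := (occursAt_append_right (packed w (G * 3) (groupDirectory w a L G)) _).trans h
  rw [length_packed] at h'
  simpa [compact] using h'

theorem groupWidth_le {a : ℕ → ℕ} {w : ℕ} (ha : ∀ i, a i < 2 ^ w) (L g : ℕ) :
    groupWidth a L g ≤ w := Nat.size_le.2 ((Nat.sub_le _ _).trans_lt (ha _))

theorem length_compact_le {a : ℕ → ℕ} {w : ℕ} (ha : ∀ i, a i < 2 ^ w) (L G : ℕ) :
    (compact w a L G).length ≤ G * (3 + L) * w := by
  have : groupsLength a L G ≤ ∑ i ∈ Finset.range G, L * w :=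
    Finset.sum_le_sum fun i _ => Nat.mul_le_mul_left _ (groupWidth_le ha L i)
  rw [Finset.sum_const, Finset.card_range, smul_eq_mul] at this
  rw [length_compact]
  calc _ ≤ G * 3 * w + G * (L * w) := by omega
    _ = _ := by ring

/-- A group either spans less than `2 ^ h`, and then `h` bits per entry suffice, or it spans at
least `q`, and then its width, at most `w`, can be charged to the span at rate `w / q`. The spans
telescope to at most `V`. The estimate is multiplied by `q` to stay within the natural numbers. -/
theorem length_compact_mul_le {a : ℕ → ℕ} (hm : Monotone a) {w : ℕ} (ha : ∀ i, a i < 2 ^ w)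
    (L G : ℕ) {V h q : ℕ} (hV : ∀ i, a i ≤ V) (hq : q ≤ 2 ^ h) :
    (compact w a L G).length * q ≤ (G * 3 * w + G * L * h) * q + L * w * V := by
  have h1 : ∀ g, groupWidth a L g * q ≤ h * q + w * (a ((g + 1) * L) - a (g * L)) := by
    intro g
    rcases lt_or_ge (a ((g + 1) * L) - a (g * L)) (2 ^ h) with hlt | hge
    · exact (Nat.mul_le_mul_right q (Nat.size_le.2 hlt)).trans (Nat.le_add_right _ _)
    · exact (Nat.mul_le_mul (groupWidth_le ha L g) (hq.trans hge)).trans (Nat.le_add_left _ _)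
  have h2 : ∀ G, groupsLength a L G * q ≤ G * L * h * q + L * w * (a (G * L) - a 0) := by
    intro G
    induction G with
    | zero => simp [groupsLength]
    | succ G ih =>
      rw [groupsLength, Finset.sum_range_succ, ← groupsLength]
      have hs : a ((G + 1) * L) - a 0 = (a ((G + 1) * L) - a (G * L)) + (a (G * L) - a 0) := by
        have := hm (Nat.zero_le (G * L))
        have := hm (Nat.mul_le_mul_right L (Nat.le_succ G))
        simp only [Nat.succ_eq_add_one] at this
        omega
      have := Nat.mul_le_mul_left L (h1 G)
      rw [hs]
      nlinarith
  rw [length_compact]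
  have h3 := h2 G
  have h4 : L * w * (a (G * L) - a 0) ≤ L * w * V :=
    Nat.mul_le_mul_left _ ((Nat.sub_le _ _).trans (hV _))
  nlinarith

namespace Expr

variable {w : ℕ} {D : List Bool} {s : Regs}

/-- The entry with index `i` of a compact array with bit index `o`. The group size is stored in the
header word `1`. -/
def compactEntry (o i : Expr) : Expr :=
  let directory (k : ℕ) : Expr :=
    entry o (bin .add (bin .mul (bin .div i (header 1)) (const 3)) (const k)) wordSize
  bin .add (directory 0) (entry (bin .add o (directory 2)) (bin .mod i (header 1)) (directory 1))

/-- Monotonicity puts `a k` between the first entry of its group and that of the next, so the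
difference fits into the width computed from these two alone. -/
theorem eval_compactEntry (hw : 2 ≤ w) (hW : word w D 0 = w) {L : ℕ} (hL : word w D 1 = L)
    (hL0 : 0 < L) (hD : D.length < 2 ^ w) {o i : Expr} {x k G : ℕ} {a : ℕ → ℕ} (hm : Monotone a)
    (ha : ∀ j, a j < 2 ^ w) (h : OccursAt D x (compact w a L G))
    (ho : o.eval w D s = x) (hi : i.eval w D s = k) (hk : k / L < G) :
    (compactEntry o i).eval w D s = a k := by
  have hw2 : w < 2 ^ w := Nat.lt_two_pow_self
  have h22 : 2 ^ 2 ≤ 2 ^ w := Nat.pow_le_pow_right (by norm_num) hw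
  have hWs : wordSize.eval w D s = w := by rw [wordSize, eval_header (by omega), hW]
  have hLs : (header 1).eval w D s = L := by rw [eval_header (by omega), hL]
  have hg := eval_div hi hLs
  have hlen := h.1
  rw [length_compact] at hlen
  have hGw : G * 3 * 2 ≤ G * 3 * w := Nat.mul_le_mul_left _ hw
  have hgl : groupsLength a L (k / L) ≤ groupsLength a L G :=
    Finset.sum_le_sum_of_subset (Finset.range_subset_range.2 hk.le)
  have hdir : ∀ j < 3, (entry o (bin .add (bin .mul (bin .div i (header 1)) (const 3)) (const j))
      wordSize).eval w D s = groupDirectory w a L G (k / L * 3 + j) := by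
    intro j hj
    refine eval_entry hw hW ho (eval_add (eval_mul hg (eval_const (by omega)) (by omega))
      (eval_const (by omega)) (by omega)) hWs hD
      (by simpa [compact] using h.trans (occursAt_append_left _ _)) (by omega) ?_ le_rfl
    unfold groupDirectory
    rw [show (k / L * 3 + j) / 3 = k / L by omega]
    split_ifs
    · exact ha _
    · exact (groupWidth_le ha _ _).trans_lt hw2
    · omega
  have e0 := hdir 0 (by omega)
  have e1 := hdir 1 (by omega)
  have e2 := hdir 2 (by omega)
  simp only [groupDirectory, show (k / L * 3 + 0) % 3 = 0 by omega,
    show (k / L * 3 + 1) % 3 = 1 by omega, show (k / L * 3 + 2) % 3 = 2 by omega,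
    show (k / L * 3 + 0) / 3 = k / L by omega, show (k / L * 3 + 1) / 3 = k / L by omega,
    show (k / L * 3 + 2) / 3 = k / L by omega] at e0 e1 e2
  norm_num at e0 e1 e2
  have hocc := h.trans (compact_occursAt_groupFields w a hk)
  have hkL : k / L * L + k % L = k := by rw [mul_comm]; exact Nat.div_add_mod k L
  have hmod := Nat.mod_lt k hL0
  have hmono1 : a (k / L * L) ≤ a k := hm (Nat.div_mul_le_self k L)
  have hmono2 : a k ≤ a ((k / L + 1) * L) := hm (by rw [Nat.succ_mul]; omega)
  have e3 := eval_entry hw hW (eval_add ho e2 (by omega)) (eval_mod hi hLs) e1 hD hocc hmod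
    (by
      rw [hkL]
      exact lt_of_le_of_lt (by omega) (Nat.lt_size_self _)) (groupWidth_le ha _ _)
  rw [hkL] at e3
  have hak := ha k
  rw [compactEntry, eval_add e0 e3 (by omega)]
  omega

/-- The number of ones among the first `x` entries of a bit vector with bit index `oB`. The bit
index `oR` is that of the compact array of the numbers of ones before each chunk, and `oT` is that
of the table of the numbers of ones of all chunks. The chunk size is stored in the header
word `2`. -/
def rank (oT oB oR x : Expr) : Expr :=
  bin .add (compactEntry oR (bin .div x (header 2)))
    (entry oT (field (bin .add oB (bin .mul (bin .div x (header 2)) (header 2)))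
      (bin .mod x (header 2))) wordSize)

end Expr

/-! ### Counting ones in bit vectors -/

/-- The bits that mark which of the first `n` numbers have the property `P`. -/
def bitVector (n : ℕ) (P : ℕ → Prop) [DecidablePred P] : List Bool :=
  List.ofFn fun i : Fin n => decide (P i.val)

@[simp] theorem length_bitVector (n : ℕ) (P : ℕ → Prop) [DecidablePred P] :
    (bitVector n P).length = n := by simp [bitVector]

/-- The number of ones among the `c` lowest digits. -/
def popCount (c y : ℕ) : ℕ := Nat.count (fun i => y.testBit i = true) c

/-- The digits of a `b`-bit field from `b` on are zero, so a single table indexed by `c`-bit numbers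
also serves incomplete chunks. -/
theorem popCount_bitsAt_bitVector {n : ℕ} {P : ℕ → Prop} [DecidablePred P] {a b c : ℕ}
    (hb : b ≤ c) (hab : a + b ≤ n) :
    popCount c (bitsAt (bitVector n P) a b) = Nat.count (fun i => P (a + i)) b := by
  obtain ⟨d, rfl⟩ := Nat.exists_eq_add_of_le hb
  rw [popCount, Nat.count_add]
  have h2 : Nat.count (fun k => (bitsAt (bitVector n P) a b).testBit (b + k) = true) d = 0 := by
    rw [Nat.count_eq_card_filter_range, Finset.card_eq_zero, Finset.filter_eq_empty_iff]
    intro i _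
    rw [testBit_bitsAt]
    simp
  rw [h2, add_zero, Nat.count_eq_card_filter_range, Nat.count_eq_card_filter_range]
  congr 1
  apply Finset.filter_congr
  intro i hi
  have hi := Finset.mem_range.1 hi
  rw [testBit_bitsAt, List.getD_eq_getElem _ _ (by simp; omega)]
  simp [bitVector, hi]

/-- The numbers of elements with property `P` before each chunk of `c` numbers. -/
def chunkCount (n c : ℕ) (P : ℕ → Prop) [DecidablePred P] (q : ℕ) : ℕ :=
  Nat.count P (min (q * c) n)

theorem monotone_chunkCount (n c : ℕ) (P : ℕ → Prop) [DecidablePred P] :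
    Monotone (chunkCount n c P) := fun _ _ h =>
  Nat.count_monotone P (min_le_min_right _ (Nat.mul_le_mul_right c h))

theorem chunkCount_le (n c : ℕ) (P : ℕ → Prop) [DecidablePred P] (q : ℕ) :
    chunkCount n c P q ≤ n := (Nat.count_le _).trans (min_le_right _ _)

/-- The count splits at the last chunk boundary before `k`. The rest is a field of `k % c` bits that
ends at index `k ≤ n`, hence inside the bit vector, and serves as the index into the table. -/
theorem Expr.eval_rank {w : ℕ} {D : List Bool} {s : Regs} (hw : 2 ≤ w) (hW : word w D 0 = w)
    {L c : ℕ} (hL : word w D 1 = L) (hc : word w D 2 = c) (hL0 : 0 < L) (hc0 : 0 < c) (hcw : c ≤ w)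
    (hD : D.length < 2 ^ w) {n : ℕ} (hn : n < 2 ^ w) {P : ℕ → Prop} [DecidablePred P]
    {oT oB oR x : Expr} {xT xB xR k G : ℕ} (hT : OccursAt D xT (packed w (2 ^ c) (popCount c)))
    (hB : OccursAt D xB (bitVector n P)) (hR : OccursAt D xR (compact w (chunkCount n c P) L G))
    (eT : oT.eval w D s = xT) (eB : oB.eval w D s = xB) (eR : oR.eval w D s = xR)
    (hx : x.eval w D s = k) (hk : k ≤ n) (hG : k / c / L < G) :
    (rank oT oB oR x).eval w D s = Nat.count P k := by
  have hw2 : w < 2 ^ w := Nat.lt_two_pow_self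
  have h22 : 2 ^ 2 ≤ 2 ^ w := Nat.pow_le_pow_right (by norm_num) hw
  have hWs : wordSize.eval w D s = w := by rw [wordSize, eval_header (by omega), hW]
  have hcs : (header 2).eval w D s = c := by rw [eval_header (by omega), hc]
  have hkc : k / c * c + k % c = k := by rw [mul_comm]; exact Nat.div_add_mod k c
  have hmod := Nat.mod_lt k hc0
  have hBl := hB.1
  rw [length_bitVector] at hBl
  have e1 := eval_compactEntry hw hW hL hL0 hD (monotone_chunkCount n c P)
    (fun q => (chunkCount_le n c P q).trans_lt hn) hR eR (eval_div hx hcs) hG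
  have e2 := eval_field hw hW
    (eval_add eB (eval_mul (eval_div hx hcs) hcs (by omega)) (by omega)) (eval_mod hx hcs)
    (by omega) (by omega)
  rw [hB.bitsAt (by rw [length_bitVector]; omega)] at e2
  have e3 := eval_entry hw hW eT e2 hWs hD hT
    ((bitsAt_lt _ _ _).trans_le (Nat.pow_le_pow_right (by norm_num) hmod.le))
    ((Nat.count_le _).trans_lt (by omega)) le_rfl
  rw [popCount_bitsAt_bitVector hmod.le (by omega)] at e3
  have h4 : chunkCount n c P (k / c) = Nat.count P (k / c * c) := by
    rw [chunkCount, min_eq_left (by omega)]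
  have h5 := Nat.count_add P (k / c * c) (k % c)
  rw [hkc] at h5
  have h6 : Nat.count P k ≤ k := Nat.count_le _
  rw [rank, eval_add e1 e3 (by omega)]
  omega

end WordRAM

/-! ### Inverting a permutation with back pointers -/

/-- There is a set of at most `δ / t` marked points, such that from every point one reaches a
marked point or returns in few steps. -/
theorem Equiv.Perm.exists_marks {δ : ℕ} (π : Equiv.Perm (Fin δ)) {t : ℕ} (ht : 0 < t) :
    ∃ M : Finset (Fin δ), M.card * t ≤ δ ∧
      ∀ x, ∃ k < 2 * t, (π ^ k) x ∈ M ∨ (π ^ (k + 1)) x = x := by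
  classical
  -- A separated set of maximal size is taken. Since `m = m'` is allowed, marks occur only on cycles
  -- of length at least `t`; points of shorter cycles fall under the second alternative.
  let Sep (M : Finset (Fin δ)) : Prop :=
    ∀ m ∈ M, ∀ m' ∈ M, ∀ k, 0 < k → k < t → (π ^ k) m ≠ m'
  obtain ⟨M, hM, hmax⟩ := Finset.exists_max_image (Finset.univ.filter Sep) Finset.card
    ⟨∅, by simp [Sep]⟩
  have hM : Sep M := (Finset.mem_filter.1 hM).2
  refine ⟨M, ?_, fun x => ?_⟩
  -- Separation makes the first `t` points of the orbits of all marked points distinct.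
  · have hinj : Function.Injective fun p : M × Fin t => (π ^ p.2.val) p.1.val := by
      rintro ⟨m, i⟩ ⟨m', j⟩ h
      have key : ∀ (m m' : M) (i j : Fin t), i ≤ j → (π ^ i.val) m.val = (π ^ j.val) m'.val →
          m = m' ∧ i = j := by
        intro m m' i j hij h
        have h1 : (π ^ (j.val - i.val)) m'.val = m.val := by
          apply (π ^ i.val).injective
          rw [h, ← Equiv.Perm.mul_apply, ← pow_add]
          congr 2
          have : i.val ≤ j.val := hij
          omega
        rcases Nat.eq_zero_or_pos (j.val - i.val) with h0 | h0
        · rw [h0] at h1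
          have : i.val ≤ j.val := hij
          exact ⟨Subtype.ext (by simpa using h1.symm), Fin.ext (by omega)⟩
        · exact absurd h1 (hM _ m'.2 _ m.2 _ h0 (by omega))
      rcases le_total i j with hij | hij
      · obtain ⟨h1, h2⟩ := key m m' i j hij h
        rw [h1, h2]
      · obtain ⟨h1, h2⟩ := key m' m j i hij h.symm
        rw [h1, h2]
    simpa using Fintype.card_le_of_injective _ hinj
  -- Maximality is tested at the point `t - 1` steps after `x`, so that a mark conflicting with `y`
  -- from behind still lies on the walk from `x`; one conflicting from ahead is reached in fewer
  -- than `2t` steps.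
  · set y := (π ^ (t - 1)) x with hy
    by_cases hyM : y ∈ M
    · exact ⟨t - 1, by omega, Or.inl hyM⟩
    have hn : ¬ Sep (insert y M) := fun h => by
      have := hmax (insert y M) (by simp [h])
      rw [Finset.card_insert_of_notMem hyM] at this
      omega
    simp only [Sep, not_forall] at hn
    obtain ⟨m, hm, m', hm', k, hk0, hkt, h⟩ := hn
    have h : (π ^ k) m = m' := by simpa using h
    rw [Finset.mem_insert] at hm hm'
    rcases hm with rfl | hm <;> rcases hm' with rfl | hm'
    · refine ⟨k - 1, by omega, Or.inr ?_⟩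
      rw [Nat.sub_add_cancel hk0]
      apply (π ^ (t - 1)).injective
      rw [← hy, ← Equiv.Perm.mul_apply, ← pow_add, add_comm, pow_add, Equiv.Perm.mul_apply, ← hy, h]
    · refine ⟨k + (t - 1), by omega, Or.inl ?_⟩
      rw [pow_add, Equiv.Perm.mul_apply, ← hy, h]
      exact hm'
    · refine ⟨t - 1 - k, by omega, Or.inl ?_⟩
      suffices (π ^ (t - 1 - k)) x = m by rwa [this]
      apply (π ^ k).injective
      rw [h, ← Equiv.Perm.mul_apply, ← pow_add, show k + (t - 1 - k) = t - 1 by omega]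
    · exact absurd h (hM m hm m' hm' k hk0 hkt)

/-! ### Running the inversion program -/

namespace WordRAM

/-- The loop changes only register `r`, so its states are described by the successive values `f i`
of that register. -/
theorem runs_while_assign {w : ℕ} {D : List Bool} {e e' : Expr} {r : ℕ} (s : Regs) (f : ℕ → ℕ)
    (k : ℕ) (h0 : s r = f 0)
    (hstep : ∀ i < k, e.eval w D (Function.update s r (f i)) ≠ 0 ∧
      e'.eval w D (Function.update s r (f i)) = f (i + 1))
    (hdone : e.eval w D (Function.update s r (f k)) = 0) :
    Runs w D (.while e (.assign r e')) s (Function.update s r (f k))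
      (k * (e.cost + e'.cost + 2) + (e.cost + 1)) := by
  induction k generalizing s f with
  | zero =>
    rw [← h0, Function.update_eq_self] at hdone ⊢
    simpa using Runs.whileDone hdone
  | succ k ih =>
    have hs := hstep 0 (by omega)
    rw [← h0, Function.update_eq_self, zero_add] at hs
    have h := Runs.whileStep hs.1 (Runs.assign r e' s)
      (ih (Function.update s r (e'.eval w D s)) (fun i => f (i + 1)) (by simp [hs.2])
        (fun i hi => by simpa using hstep (i + 1) (by omega)) (by simpa using hdone))
    rw [Function.update_idem] at h
    convert h using 1
    ring

/-- Follow the permutation from the point in register `1` until its preimage is in register `2`,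
using one back pointer. The expressions give the image of the point in register `2`, whether it is
marked, and its back pointer. -/
def invert (image marked back : Expr) : Prog :=
  .seq (.assign 2 (.reg 1))
    (.seq (.while (.bin .eq (.bin .or marked (.bin .eq image (.reg 1))) (.const 0)) (.assign 2 image))
      (.seq (.ite (.bin .eq image (.reg 1)) .skip (.assign 2 back))
        (.while (.bin .eq (.bin .eq image (.reg 1)) (.const 0)) (.assign 2 image))))

/-- The walk from `x` stops after `k < 2t` steps, either at the preimage of `x` or at a marked
point. In the latter case a jump of `2t` steps back passes `x`, and walking forward from there meets
the preimage after at most `2t - k - 1` steps. -/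
theorem runs_invert {w : ℕ} {D : List Bool} (image marked back : Expr) {δ t : ℕ}
    (π : Equiv.Perm (Fin δ)) (M : Finset (Fin δ))
    (hM : ∀ x, ∃ k < 2 * t, (π ^ k) x ∈ M ∨ (π ^ (k + 1)) x = x)
    (hi : ∀ (s : Regs) (z : Fin δ), s 2 = z.val → image.eval w D s = (π z).val)
    (hm : ∀ (s : Regs) (z : Fin δ), s 2 = z.val → marked.eval w D s = if z ∈ M then 1 else 0)
    (hb : ∀ (s : Regs) (z : Fin δ), s 2 = z.val → z ∈ M →
      back.eval w D s = ((π ^ (2 * t)).symm z).val)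
    (s : Regs) (x : Fin δ) (hx : s 1 = x.val) :
    ∃ T ≤ (t + 1) * (8 * (image.cost + marked.cost + back.cost + 10)),
      Runs w D (invert image marked back) s (Function.update s 2 (π.symm x).val) T := by
  classical
  have hreg : ∀ v, (Function.update s 2 v) 1 = x.val := fun v => by
    rw [Function.update_of_ne (by norm_num), hx]
  have hfound : ∀ z : Fin δ, (Expr.bin .eq image (.reg 1)).eval w D (Function.update s 2 z.val)
      = if π z = x then 1 else 0 := fun z => by
    rw [Expr.eval_eq (hi (Function.update s 2 z.val) z (by simp)) (Expr.eval_reg (hreg _))]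
    simp [Fin.ext_iff]
  have hzero : ∀ s, (Expr.const 0).eval w D s = 0 := fun s => by simp [Expr.eval]
  have hgo : ∀ z : Fin δ, (Expr.bin .eq (.bin .or marked (.bin .eq image (.reg 1))) (.const 0)).eval
      w D (Function.update s 2 z.val) = if z ∈ M ∨ π z = x then 0 else 1 := fun z => by
    rw [Expr.eval_eq (Expr.eval_or (hm _ z (by simp)) (hfound z)) (hzero _)]
    by_cases h1 : z ∈ M <;> by_cases h2 : π z = x <;> simp [h1, h2]
  have hgo' : ∀ z : Fin δ, (Expr.bin .eq (.bin .eq image (.reg 1)) (.const 0)).eval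
      w D (Function.update s 2 z.val) = if π z = x then 0 else 1 := fun z => by
    rw [Expr.eval_eq (hfound z) (hzero _)]
    by_cases h2 : π z = x <;> simp [h2]
  -- the walk to the first marked point
  have hex : ∃ k, (π ^ k) x ∈ M ∨ (π ^ (k + 1)) x = x := (hM x).imp fun k hk => hk.2
  set k := Nat.find hex with hk
  have hkt : k < 2 * t := by
    obtain ⟨k', h1, h2⟩ := hM x
    exact (Nat.find_min' hex h2).trans_lt h1
  have hkspec := Nat.find_spec hex
  rw [← hk] at hkspec
  have hsucc : ∀ i (z : Fin δ), π ((π ^ i) z) = (π ^ (i + 1)) z := fun i z => by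
    rw [pow_succ', Equiv.Perm.mul_apply]
  have r1 := Runs.assign (w := w) (D := D) 2 (.reg 1) s
  have r2 := runs_while_assign (w := w) (D := D)
    (e := .bin .eq (.bin .or marked (.bin .eq image (.reg 1))) (.const 0)) (e' := image) (r := 2)
    (Function.update s 2 x.val) (fun i => ((π ^ i) x).val) k (by simp)
    (fun i hik => by
      have := Nat.find_min hex hik
      rw [Function.update_idem, hgo, hi _ _ (Function.update_self _ _ _), hsucc]
      simp only [this, if_false]
      simp)
    (by rw [Function.update_idem, hgo, hsucc, if_pos hkspec])
  rw [Function.update_idem] at r2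
  have r1' : Runs w D (.assign 2 (.reg 1)) s (Function.update s 2 x.val) 2 := by
    simpa [Expr.eval, hx, Expr.cost] using r1
  -- the walk to the preimage
  have walk : ∀ (y : Fin δ) (j : ℕ), (π ^ (j + 1)) y = x → ∃ i ≤ j,
      Runs w D (.while (.bin .eq (.bin .eq image (.reg 1)) (.const 0)) (.assign 2 image))
        (Function.update s 2 y.val) (Function.update s 2 (π.symm x).val)
        (i * ((Expr.bin .eq (.bin .eq image (.reg 1)) (.const 0)).cost + image.cost + 2)
          + ((Expr.bin .eq (.bin .eq image (.reg 1)) (.const 0)).cost + 1)) := by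
    intro y j hj
    have hex' : ∃ i, (π ^ (i + 1)) y = x := ⟨j, hj⟩
    have hspec := Nat.find_spec hex'
    refine ⟨Nat.find hex', Nat.find_min' hex' hj, ?_⟩
    have r := runs_while_assign (w := w) (D := D)
      (e := .bin .eq (.bin .eq image (.reg 1)) (.const 0)) (e' := image) (r := 2)
      (Function.update s 2 y.val) (fun i => ((π ^ i) y).val) (Nat.find hex') (by simp)
      (fun i hik => by
        have := Nat.find_min hex' hik
        rw [Function.update_idem, hgo', hi _ _ (Function.update_self _ _ _), hsucc]
        simp [this])
      (by rw [Function.update_idem, hgo', hsucc, if_pos hspec])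
    rw [Function.update_idem] at r
    have he : (π ^ Nat.find hex') y = π.symm x := by
      rw [Equiv.eq_symm_apply, hsucc, hspec]
    rwa [he] at r
  have hz := hfound ((π ^ k) x)
  by_cases hret : π ((π ^ k) x) = x
  -- The cycle has closed: no back pointer is used, and the second loop ends without a round.
  · obtain ⟨i, hi0, r4⟩ := walk ((π ^ k) x) 0 (by rw [pow_one, hret])
    have r3 := Runs.iteTrue (c₂ := .assign 2 back) (by rw [hz, if_pos hret]; norm_num)
      (Runs.skip (w := w) (D := D) (Function.update s 2 ((π ^ k) x).val))
    refine ⟨_, ?_, Runs.seq r1' (Runs.seq r2 (Runs.seq r3 r4))⟩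
    obtain rfl : i = 0 := by omega
    simp only [Expr.cost]
    nlinarith [Nat.zero_le (t * marked.cost), Nat.zero_le (t * back.cost),
      Nat.zero_le (t * image.cost), Nat.mul_le_mul_right
        (marked.cost + (image.cost + 1 + 1) + 1 + 1 + 1 + image.cost + 2) hkt.le]
  · have hkM : (π ^ k) x ∈ M := hkspec.resolve_right (by rwa [← hsucc])
    obtain ⟨i, hi0, r4⟩ := walk ((π ^ (2 * t)).symm ((π ^ k) x)) (2 * t - k - 1) (by
      apply (π ^ k).injective
      rw [← Equiv.Perm.mul_apply, ← pow_add, show k + (2 * t - k - 1 + 1) = 2 * t by omega]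
      exact Equiv.apply_symm_apply _ _)
    have r3 := Runs.iteFalse (w := w) (D := D) (c₁ := .skip) (by rw [hz, if_neg hret])
      (Runs.assign 2 back (Function.update s 2 ((π ^ k) x).val))
    rw [hb _ _ (Function.update_self _ _ _) hkM, Function.update_idem] at r3
    refine ⟨_, ?_, Runs.seq r1' (Runs.seq r2 (Runs.seq r3 r4))⟩
    have hi1 : i ≤ 2 * t := by omega
    simp only [Expr.cost]
    nlinarith [Nat.zero_le (t * marked.cost), Nat.zero_le (t * back.cost),
      Nat.zero_le (t * image.cost), Nat.mul_le_mul_right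
        (marked.cost + (image.cost + 1 + 1) + 1 + 1 + 1 + image.cost + 2) hkt.le,
      Nat.mul_le_mul_right (image.cost + 1 + 1 + 1 + 1 + image.cost + 2) hi1]

end WordRAM

/-! ### The block structure of an array and of its sorted version -/

theorem Nat.exists_last_of_le {P : ℕ → Prop} [DecidablePred P] (h0 : P 0) (p : ℕ) :
    ∃ s ≤ p, P s ∧ (∀ i, s < i → i ≤ p → ¬ P i) ∧ Nat.count P (p + 1) = Nat.count P s + 1 := by
  induction p with
  | zero => exact ⟨0, le_rfl, h0, fun i _ _ => by omega, by simp [Nat.count_succ, h0]⟩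
  | succ p ih =>
    by_cases hp : P (p + 1)
    · exact ⟨p + 1, le_rfl, hp, fun i _ _ => by omega, by rw [Nat.count_succ, if_pos hp]⟩
    · obtain ⟨s, hs, h1, h2, h3⟩ := ih
      refine ⟨s, by omega, h1, fun i hi hip => ?_, by rw [Nat.count_succ, if_neg hp, h3]⟩
      rcases hip.eq_or_lt with rfl | h
      · exact hp
      · exact h2 i hi (by omega)

theorem Nat.count_succ_eq_of_last {P : ℕ → Prop} [DecidablePred P] {s p : ℕ} (hsp : s ≤ p)
    (hs : P s) (h : ∀ i, s < i → i ≤ p → ¬ P i) : Nat.count P (p + 1) = Nat.count P s + 1 := by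
  induction p, hsp using Nat.le_induction with
  | base => rw [Nat.count_succ, if_pos hs]
  | succ p hp ih =>
    rw [Nat.count_succ, if_neg (h _ (by omega) le_rfl), ih fun i h1 h2 => h i h1 (by omega)]

section BlockStructure

variable {α : Type*} [LinearOrder α] {n : ℕ} (A : Fin n → α)

/-- The position `i` starts a block (by convention, so do all numbers beyond the array). -/
def IsBlockStart (i : ℕ) : Prop := ∀ h : i < n, StartsBlock A ⟨i, h⟩

/-- The entry with index `j` of the sorted array starts a block. -/
def IsSortedBlockStart (j : ℕ) : Prop := ∀ h : j < n, IsBlockStart A (Tuple.sort A ⟨j, h⟩).val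

noncomputable instance : DecidablePred (IsBlockStart A) := Classical.decPred _

noncomputable instance : DecidablePred (IsSortedBlockStart A) := Classical.decPred _

/-- Counting the numbers beyond the array as starts makes `Nat.nth` strictly monotone everywhere, so
the sequences of starts are monotone past the last block too. -/
theorem infinite_isBlockStart : (Set.ofPred (IsBlockStart A)).Infinite :=
  (Set.Ici_infinite n).mono fun _ hi h => absurd h (not_lt.2 hi)

theorem infinite_isSortedBlockStart : (Set.ofPred (IsSortedBlockStart A)).Infinite :=
  (Set.Ici_infinite n).mono fun _ hi h => absurd h (not_lt.2 hi)

theorem Nat.count_eq_card_fin (P : ℕ → Prop) [DecidablePred P] (n : ℕ) :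
    Nat.count P n = (Finset.univ.filter fun i : Fin n => P i.val).card := by
  rw [Nat.count_eq_card_filter_range]
  refine (Finset.card_nbij (fun i : Fin n => i.val) ?_ ?_ ?_).symm
  · intro i hi
    simpa using hi
  · exact fun i _ j _ h => Fin.ext h
  · intro i hi
    have hi : i < n ∧ P i := by simpa using hi
    exact ⟨⟨i, hi.1⟩, by simpa using hi.2, rfl⟩

theorem count_isBlockStart : Nat.count (IsBlockStart A) n = numBlocks A := by
  classical
  rw [Nat.count_eq_card_fin, numBlocks]
  congr 1
  ext i
  exact ⟨fun h => Finset.mem_filter.2 ⟨Finset.mem_univ i, (Finset.mem_filter.1 h).2 i.2⟩,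
    fun h => Finset.mem_filter.2 ⟨Finset.mem_univ i, fun _ => (Finset.mem_filter.1 h).2⟩⟩

/-- Sorting is a bijection between the starts in the sorted array and those in `A`. -/
theorem count_isSortedBlockStart : Nat.count (IsSortedBlockStart A) n = numBlocks A := by
  rw [← count_isBlockStart, Nat.count_eq_card_fin, Nat.count_eq_card_fin]
  refine Finset.card_nbij (Tuple.sort A) ?_ ((Tuple.sort A).injective.injOn) ?_
  · intro j hj
    simpa [IsSortedBlockStart] using hj
  · intro i hi
    refine ⟨(Tuple.sort A).symm i, ?_, Equiv.apply_symm_apply _ _⟩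
    simpa [IsSortedBlockStart] using hi

theorem isBlockStart_zero : IsBlockStart A 0 := fun _ => Or.inl fun _ hp => by simp at hp

variable {A}

/-- Stability of `Tuple.sort`: the sorted order is the lexicographic order of value and position. -/
theorem sort_lt_iff {i j : Fin n} : i < j ↔ A (Tuple.sort A i) < A (Tuple.sort A j) ∨
    A (Tuple.sort A i) = A (Tuple.sort A j) ∧ Tuple.sort A i < Tuple.sort A j := by
  obtain ⟨hm, hs⟩ := Tuple.eq_sort_iff.1 (rfl : Tuple.sort A = Tuple.sort A)
  have key : ∀ i j : Fin n, i < j → A (Tuple.sort A i) < A (Tuple.sort A j) ∨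
      A (Tuple.sort A i) = A (Tuple.sort A j) ∧ Tuple.sort A i < Tuple.sort A j := fun i j h => by
    rcases (hm h.le : A (Tuple.sort A i) ≤ A (Tuple.sort A j)).lt_or_eq with h1 | h1
    · exact Or.inl h1
    · exact Or.inr ⟨h1, hs i j h h1⟩
  refine ⟨key i j, fun h => ?_⟩
  by_contra hn
  rcases (not_lt.1 hn).eq_or_lt with rfl | h'
  · rcases h with h | ⟨-, h⟩ <;> exact lt_irrefl _ h
  · rcases key j i h' with h1 | ⟨h1, h2⟩ <;> rcases h with h | ⟨h, h3⟩
    · exact lt_asymm h h1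
    · exact h1.ne' h
    · exact h.ne' h1
    · exact lt_asymm h2 h3

theorem sort_symm_lt_iff {p q : Fin n} : (Tuple.sort A).symm p < (Tuple.sort A).symm q ↔
    A p < A q ∨ A p = A q ∧ p < q := by
  rw [sort_lt_iff (A := A), Equiv.apply_symm_apply, Equiv.apply_symm_apply]

theorem eq_of_multiplicityIn_eq_one {x : α} (h : multiplicityIn A x = 1) {p q : Fin n}
    (hp : A p = x) (hq : A q = x) : p = q :=
  Finset.card_le_one.1 h.le p (by simpa using hp) q (by simpa using hq)

theorem exists_sameBlock_of_not_isBlockStart {i : ℕ} (h : ¬ IsBlockStart A (i + 1)) :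
    ∃ hi : i + 1 < n, SameBlock A ⟨i, by omega⟩ ⟨i + 1, hi⟩ := by
  simp only [IsBlockStart, StartsBlock, not_forall, not_or, not_not] at h
  obtain ⟨hi, -, p, hp, hs⟩ := h
  refine ⟨hi, ?_⟩
  have hp : p.val = i := by simpa using hp
  rwa [show p = ⟨i, by omega⟩ from Fin.ext hp] at hs

/-- An entry `q` strictly between the two in the sorted order would either have their common value
and a position between `i` and `i + 1`, or have a value strictly between theirs, or repeat a value
of multiplicity one. -/
theorem SameBlock.sort_symm {i : ℕ} {hi : i + 1 < n}
    (h : SameBlock A ⟨i, by omega⟩ ⟨i + 1, hi⟩) :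
    ((Tuple.sort A).symm ⟨i + 1, hi⟩).val = ((Tuple.sort A).symm ⟨i, by omega⟩).val + 1 := by
  set u := (Tuple.sort A).symm ⟨i, by omega⟩ with hu
  set v := (Tuple.sort A).symm ⟨i + 1, hi⟩ with hv
  have huv : u < v := by
    rw [hu, hv, sort_symm_lt_iff]
    rcases h with h | h
    · exact Or.inr ⟨h, by simp⟩
    · exact Or.inl h.1
  by_contra hne
  have huv' : u.val < v.val := huv
  have hk : u.val + 1 < n := by omega
  obtain ⟨q, hq⟩ : ∃ q, (Tuple.sort A).symm q = ⟨u.val + 1, hk⟩ := (Tuple.sort A).symm.surjective _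
  have h1 : u < (Tuple.sort A).symm q := by rw [hq]; exact Nat.lt_succ_self _
  have h2 : (Tuple.sort A).symm q < v := by
    rw [hq]
    change u.val + 1 < v.val
    omega
  rw [hu, sort_symm_lt_iff] at h1
  rw [hv, sort_symm_lt_iff] at h2
  rcases h with h | ⟨h, m1, m2, hno⟩
  · rcases h1 with h1 | ⟨h1, h1'⟩ <;> rcases h2 with h2 | ⟨h2, h2'⟩
    · exact absurd (h1.trans h2) (by rw [h]; exact lt_irrefl _)
    · rw [h, h2] at h1; exact lt_irrefl _ h1
    · rw [← h1, h] at h2; exact lt_irrefl _ h2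
    · have h1' : i < q.val := h1'
      have h2' : q.val < i + 1 := h2'
      omega
  · rcases h1 with h1 | ⟨h1, h1'⟩
    · rcases h2 with h2 | ⟨h2, h2'⟩
      · exact hno q ⟨h1, h2⟩
      · exact h2'.ne (eq_of_multiplicityIn_eq_one m2 h2 rfl)
    · exact h1'.ne (eq_of_multiplicityIn_eq_one m1 rfl h1.symm)

/-- In a block the indices in the sorted array are consecutive, and either all multiplicities are
one or all values are equal. -/
theorem block_structure {s : ℕ} (d : ℕ) (hd : s + d < n)
    (h : ∀ i, s < i → i ≤ s + d → ¬ IsBlockStart A i) :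
    ((Tuple.sort A).symm ⟨s + d, hd⟩).val = ((Tuple.sort A).symm ⟨s, by omega⟩).val + d ∧
    (multiplicityIn A (A ⟨s + d, hd⟩) = 1 ↔ multiplicityIn A (A ⟨s, by omega⟩) = 1) ∧
    (multiplicityIn A (A ⟨s, by omega⟩) ≠ 1 → A ⟨s + d, hd⟩ = A ⟨s, by omega⟩) := by
  induction d with
  | zero => simp
  | succ d ih =>
    obtain ⟨h1, h2, h3⟩ := ih (by omega) fun i hi hi' => h i hi (by omega)
    obtain ⟨hlt, hsb⟩ := exists_sameBlock_of_not_isBlockStart (h (s + d + 1) (by omega) (by omega))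
    refine ⟨?_, ?_⟩
    · have := hsb.sort_symm
      simp only [← add_assoc]
      omega
    · rcases hsb with he | ⟨-, m1, m2, -⟩
      · simp only [← add_assoc]
        rw [← he]
        exact ⟨h2, h3⟩
      · have hs := h2.1 m1
        exact ⟨⟨fun _ => hs, fun _ => m2⟩, fun hne => absurd hs hne⟩

/-- With no ties, the entries before `p` in the sorted order are exactly the smaller ones. -/
theorem rankIn_eq_of_multiplicityIn_eq_one {p : Fin n} (h : multiplicityIn A (A p) = 1) :
    rankIn A (A p) = ((Tuple.sort A).symm p).val := by
  have h1 : rankIn A (A p) = (Finset.univ.filter fun j : Fin n => j < (Tuple.sort A).symm p).card := by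
    refine Finset.card_nbij (Tuple.sort A).symm ?_ ((Tuple.sort A).symm.injective.injOn) ?_
    · intro q hq
      have hq : A q < A p := by simpa using hq
      simpa using sort_symm_lt_iff.2 (Or.inl hq)
    · intro j hj
      have hj : j < (Tuple.sort A).symm p := by simpa using hj
      refine ⟨Tuple.sort A j, ?_, Equiv.symm_apply_apply _ _⟩
      have h2 := (sort_lt_iff (A := A)).1 hj
      rw [Equiv.apply_symm_apply] at h2
      rcases h2 with h2 | ⟨h2, h3⟩
      · simpa using h2
      · exact absurd (eq_of_multiplicityIn_eq_one h h2 rfl) h3.ne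
  rw [h1, ← Fin.card_Iio]
  congr 1
  ext j
  simp

theorem rankIn_lt_rankIn {p q : Fin n} (h : A p < A q) : rankIn A (A p) < rankIn A (A q) := by
  apply Finset.card_lt_card
  refine ⟨fun r hr => ?_, fun hsub => ?_⟩
  · have hr : A r < A p := by simpa using hr
    simpa using hr.trans h
  · have := hsub (show p ∈ _ by simpa using h)
    simp at this

theorem rankIn_le (x : α) : rankIn A x ≤ n :=
  (Finset.card_filter_le _ _).trans (by simp)

variable (A)

/-- Twice the rank of the value `x`, plus one if its multiplicity is not one. -/
def valueKey (x : α) : ℕ := 2 * rankIn A x + if multiplicityIn A x = 1 then 0 else 1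

/-- The key of the first value of the `r`-th block of the sorted array. -/
noncomputable def blockKey (r : ℕ) : ℕ :=
  if h : Nat.nth (IsSortedBlockStart A) r < n then valueKey A (A (Tuple.sort A ⟨_, h⟩))
  else 2 * n + 1

theorem valueKey_le (x : α) : valueKey A x ≤ 2 * n + 1 := by
  have := rankIn_le (A := A) x
  unfold valueKey
  split_ifs <;> omega

theorem blockKey_le (r : ℕ) : blockKey A r ≤ 2 * n + 1 := by
  unfold blockKey
  split_ifs
  · exact valueKey_le A _
  · exact le_rfl

/-- A larger value has a strictly larger rank, and doubling the rank leaves room for the flag bit.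
The default `2 * n + 1` bounds every key, so monotonicity persists beyond the last block. -/
theorem monotone_blockKey : Monotone (blockKey A) := by
  intro r r' hr
  have hn := (Nat.nth_strictMono (infinite_isSortedBlockStart A)).monotone hr
  by_cases h' : Nat.nth (IsSortedBlockStart A) r' < n
  · have h : Nat.nth (IsSortedBlockStart A) r < n := hn.trans_lt h'
    rw [blockKey, blockKey, dif_pos h, dif_pos h']
    have hm := Tuple.monotone_sort A (show (⟨_, h⟩ : Fin n) ≤ ⟨_, h'⟩ from hn)
    rcases (show A (Tuple.sort A ⟨_, h⟩) ≤ A (Tuple.sort A ⟨_, h'⟩) from hm).eq_or_lt with he | hl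
    · rw [he]
    · have := rankIn_lt_rankIn hl
      unfold valueKey
      split_ifs <;> omega
  · conv_rhs => rw [blockKey, dif_neg h']
    exact blockKey_le A r

theorem nth_isSortedBlockStart_lt {r : ℕ} (hr : r < numBlocks A) :
    Nat.nth (IsSortedBlockStart A) r < n :=
  Nat.nth_lt_of_lt_count (by rwa [count_isSortedBlockStart])

theorem nth_isBlockStart_lt {r : ℕ} (hr : r < numBlocks A) : Nat.nth (IsBlockStart A) r < n :=
  Nat.nth_lt_of_lt_count (by rwa [count_isBlockStart])

/-- The position of the first entry of the `r`-th block of the sorted array. -/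
noncomputable def sortedBlockPos (r : Fin (numBlocks A)) : Fin n :=
  Tuple.sort A ⟨_, nth_isSortedBlockStart_lt A r.2⟩

theorem isBlockStart_sortedBlockPos (r : Fin (numBlocks A)) :
    IsBlockStart A (sortedBlockPos A r).val :=
  Nat.nth_mem_of_infinite (infinite_isSortedBlockStart A) r.val _

theorem sortedBlockPos_injective : Function.Injective (sortedBlockPos A) := fun r r' h => by
  have := (Tuple.sort A).injective h
  exact Fin.ext ((Nat.nth_strictMono (infinite_isSortedBlockStart A)).injective
    (congrArg Fin.val this))

theorem count_lt_numBlocks {i : ℕ} (h : IsBlockStart A i) (hi : i < n) :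
    Nat.count (IsBlockStart A) i < numBlocks A := by
  rw [← count_isBlockStart]
  exact Nat.count_strict_mono h hi

/-- The permutation that maps the index of a block in the sorted array to its index in the
array. -/
noncomputable def blockPerm : Equiv.Perm (Fin (numBlocks A)) :=
  Equiv.ofBijective
    (fun r => ⟨Nat.count (IsBlockStart A) (sortedBlockPos A r).val,
      count_lt_numBlocks A (isBlockStart_sortedBlockPos A r) (sortedBlockPos A r).2⟩)
    (Finite.injective_iff_bijective.1 fun r r' h => sortedBlockPos_injective A (Fin.ext
      (Nat.count_injective (isBlockStart_sortedBlockPos A r) (isBlockStart_sortedBlockPos A r')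
        (congrArg Fin.val h))))

theorem nth_blockPerm (r : Fin (numBlocks A)) :
    Nat.nth (IsBlockStart A) (blockPerm A r).val = (sortedBlockPos A r).val :=
  Nat.nth_count (isBlockStart_sortedBlockPos A r)

/-- The block that contains the position `p`. -/
theorem exists_block (p : Fin n) : ∃ r : Fin (numBlocks A),
    Nat.count (IsBlockStart A) (p.val + 1) = (blockPerm A r).val + 1 ∧
    Nat.count (IsSortedBlockStart A) (((Tuple.sort A).symm p).val + 1) = r.val + 1 ∧
    (sortedBlockPos A r).val ≤ p.val ∧
    ((Tuple.sort A).symm p).val =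
      Nat.nth (IsSortedBlockStart A) r.val + (p.val - (sortedBlockPos A r).val) ∧
    rankIn A (A p) = blockKey A r.val / 2 +
      (p.val - (sortedBlockPos A r).val) * (1 - blockKey A r.val % 2) := by
  -- `s` is the start of the block of `p`; `j` below is its index in the sorted array.
  obtain ⟨s, hsp, hs, hno, hc⟩ := Nat.exists_last_of_le (isBlockStart_zero A) p.val
  have hsn : s < n := hsp.trans_lt p.2
  set j := (Tuple.sort A).symm ⟨s, hsn⟩ with hj
  have hjs : Tuple.sort A j = ⟨s, hsn⟩ := Equiv.apply_symm_apply _ _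
  have hjS : IsSortedBlockStart A j.val := fun _ => by
    rw [Fin.eta, hjs]
    exact hs
  have hr : Nat.count (IsSortedBlockStart A) j.val < numBlocks A := by
    rw [← count_isSortedBlockStart]
    exact Nat.count_strict_mono hjS j.2
  have hpos : sortedBlockPos A ⟨_, hr⟩ = ⟨s, hsn⟩ := by
    rw [sortedBlockPos, ← hjs]
    congr 1
    exact Fin.ext (Nat.nth_count hjS)
  have hstr : ∀ d (hd : s + d ≤ p.val), _ := fun d hd =>
    block_structure (A := A) (s := s) d (by omega) fun i h1 h2 => hno i h1 (by omega)
  obtain ⟨h1, h2, h3⟩ := hstr (p.val - s) (by omega)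
  have hpe : (⟨s + (p.val - s), by omega⟩ : Fin n) = p := Fin.ext (by simp; omega)
  simp only [hpe] at h1 h2 h3
  rw [← hj] at h1
  refine ⟨⟨_, hr⟩, ?_, ?_, ?_, ?_, ?_⟩
  · rw [hc]
    congr 1
    change _ = Nat.count (IsBlockStart A) (sortedBlockPos A _).val
    rw [hpos]
  -- A sorted block start strictly after `j`, up to the index of `p`, would come from a block start
  -- strictly after `s`, up to `p`, since the block is moved rigidly.
  · rw [Nat.count_succ_eq_of_last (s := j.val) (by omega) hjS]
    intro i hi hi' hS
    have hin : i < n := by omega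
    have h4 := (hstr (i - j.val) (by omega)).1
    rw [← hj, show j.val + (i - j.val) = i by omega] at h4
    have h5 : Tuple.sort A ⟨i, hin⟩ = ⟨s + (i - j.val), by omega⟩ := by
      rw [← Equiv.eq_symm_apply]
      exact Fin.ext h4.symm
    have h6 := hS hin
    rw [h5] at h6
    exact hno _ (by simp; omega) (by simp; omega) h6
  · rw [hpos]; exact hsp
  · rw [hpos, h1]
    congr 1
    exact (Nat.nth_count hjS).symm
  · have hkey : blockKey A (Nat.count (IsSortedBlockStart A) j.val) = valueKey A (A ⟨s, hsn⟩) := by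
      have h := nth_isSortedBlockStart_lt A hr
      rw [blockKey, dif_pos h, ← hpos]
      rfl
    rw [hpos, hkey, valueKey]
    -- With flag `0`, rank equals sorted index and grows with the offset; with flag `1`, all values
    -- of the block agree and the factor `1 - 1` cancels the offset.
    by_cases hm : multiplicityIn A (A ⟨s, hsn⟩) = 1
    · rw [if_pos hm, rankIn_eq_of_multiplicityIn_eq_one (h2.2 hm),
        rankIn_eq_of_multiplicityIn_eq_one hm, h1, ← hj]
      simp
    · rw [if_neg hm, h3 hm, Nat.mul_add_mod, Nat.mul_add_div (by norm_num)]
      simp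

end BlockStructure

namespace WordRAM

/-! ### Memory layout -/

/-- The header of a memory: four parameters, then the bit indices of the segments. -/
def memoryHeader (w : ℕ) (v : ℕ → ℕ) (segs : List (List Bool)) (k : ℕ) : ℕ :=
  if k < 4 then v k else (4 + segs.length) * w + (segs.take (k - 4)).flatten.length

/-- A memory that consists of a header and a list of segments. -/
def memory (w : ℕ) (v : ℕ → ℕ) (segs : List (List Bool)) : List Bool :=
  packed w (4 + segs.length) (memoryHeader w v segs) ++ segs.flatten

theorem length_memory (w : ℕ) (v : ℕ → ℕ) (segs : List (List Bool)) :
    (memory w v segs).length = (4 + segs.length) * w + segs.flatten.length := by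
  simp [memory]

theorem word_memory {w : ℕ} {v : ℕ → ℕ} {segs : List (List Bool)} {k : ℕ}
    (hk : k < 4 + segs.length) (h : memoryHeader w v segs k < 2 ^ w) :
    word w (memory w v segs) k = memoryHeader w v segs k := by
  have := (occursAt_append_left (packed w (4 + segs.length) (memoryHeader w v segs))
    segs.flatten).bitsAt_packed hk h
  rwa [zero_add] at this

theorem memory_occursAt {w : ℕ} {v : ℕ → ℕ} {segs : List (List Bool)}
    (h : (memory w v segs).length < 2 ^ w) (k : ℕ) (hk : k < segs.length) :
    OccursAt (memory w v segs) (word w (memory w v segs) (4 + k)) segs[k] := by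
  have ho := occursAt_flatten segs k hk
  have h1 := ho.1
  rw [length_memory] at h
  have hh : memoryHeader w v segs (4 + k)
      = (4 + segs.length) * w + (segs.take k).flatten.length := by simp [memoryHeader]
  rw [word_memory (by omega) (by omega), hh]
  have h2 := (occursAt_append_right (packed w (4 + segs.length) (memoryHeader w v segs)) _).trans ho
  rwa [length_packed] at h2

/-! ### The data structure -/

section Encoding

variable {α : Type*} [LinearOrder α] {n : ℕ}

/-- The size of the groups of compact arrays. -/
def groupSize (n : ℕ) : ℕ := (Nat.log 2 n + 1) ^ 2

/-- The size of the chunks of bit vectors. -/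
def chunkSize (n : ℕ) : ℕ := Nat.log 2 n / 2 + 1

/-- The compact array of the first `m` entries of a sequence. -/
def compactArray (w n : ℕ) (a : ℕ → ℕ) (m : ℕ) : List Bool :=
  compact w a (groupSize n) (m / groupSize n + 1)

variable (A : Fin n → α) (M : Finset (Fin (numBlocks A))) (t : ℕ)

/-- The block with index `z` in the sorted array is marked. -/
def IsMarked (z : ℕ) : Prop := ∃ h : z < numBlocks A, (⟨z, h⟩ : Fin (numBlocks A)) ∈ M

noncomputable instance : DecidablePred (IsMarked A M) := Classical.decPred _

/-- The image of the index `z` under the block permutation. -/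
noncomputable def blockImage (z : ℕ) : ℕ :=
  if h : z < numBlocks A then (blockPerm A ⟨z, h⟩).val else 0

/-- The back pointer of the marked index number `u`. -/
noncomputable def backPointer (u : ℕ) : ℕ :=
  if h : Nat.nth (IsMarked A M) u < numBlocks A then ((blockPerm A ^ (2 * t)).symm ⟨_, h⟩).val
  else 0

/-- The parameters of the data structure. -/
noncomputable def parameters (w k : ℕ) : ℕ :=
  if k = 0 then w else if k = 1 then groupSize n else if k = 2 then chunkSize n
  else Nat.log 2 (numBlocks A) + 1

/-- The segments of the data structure. -/
noncomputable def segments (w : ℕ) : List (List Bool) :=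
  [packed w (2 ^ chunkSize n) (popCount (chunkSize n)),
    bitVector n (IsBlockStart A),
    bitVector n (IsSortedBlockStart A),
    compactArray w n (chunkCount n (chunkSize n) (IsBlockStart A)) (n / chunkSize n),
    compactArray w n (chunkCount n (chunkSize n) (IsSortedBlockStart A)) (n / chunkSize n),
    packed (Nat.log 2 (numBlocks A) + 1) (numBlocks A) (blockImage A),
    packed (Nat.log 2 (numBlocks A) + 1) M.card (backPointer A M t),
    compactArray w n (fun r => min (Nat.nth (IsBlockStart A) r) n) (numBlocks A),
    compactArray w n (fun r => min (Nat.nth (IsSortedBlockStart A) r) n) (numBlocks A),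
    compactArray w n (blockKey A) (numBlocks A),
    compactArray w n (fun z => Nat.count (IsMarked A M) (min z n)) (numBlocks A)]

/-- The data structure. -/
noncomputable def encoding (w : ℕ) : List Bool :=
  memory w (parameters A w) (segments A M t w)

variable {A M t}

theorem numBlocks_le : numBlocks A ≤ n := by
  rw [← count_isBlockStart]; exact Nat.count_le _

/-- A compact array also evaluates its sequence beyond the last block; the cap at `n` keeps it
bounded there and does not affect the entries that are used. -/
theorem monotone_min_nth {P : ℕ → Prop} (hP : (Set.ofPred P).Infinite) (n : ℕ) :
    Monotone fun r => min (Nat.nth P r) n := fun _ _ h =>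
  min_le_min_right _ ((Nat.nth_strictMono hP).monotone h)

theorem monotone_count_min (P : ℕ → Prop) [DecidablePred P] (n : ℕ) :
    Monotone fun z => Nat.count P (min z n) := fun _ _ h =>
  Nat.count_monotone P (min_le_min_right _ h)

theorem count_min_le (P : ℕ → Prop) [DecidablePred P] (n z : ℕ) : Nat.count P (min z n) ≤ n :=
  (Nat.count_le _).trans (min_le_right _ _)

theorem lt_two_pow_of_lt_numBlocks {z : ℕ} (h : z < numBlocks A) :
    z < 2 ^ (Nat.log 2 (numBlocks A) + 1) :=
  h.trans (Nat.lt_pow_succ_log_self (by norm_num) _)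

theorem blockImage_lt {z : ℕ} (h : z < numBlocks A) :
    blockImage A z < 2 ^ (Nat.log 2 (numBlocks A) + 1) := by
  rw [blockImage, dif_pos h]
  exact lt_two_pow_of_lt_numBlocks (Fin.is_lt _)

theorem count_isMarked : Nat.count (IsMarked A M) (numBlocks A) = M.card := by
  rw [Nat.count_eq_card_fin]
  congr 1
  ext z
  simp [IsMarked]

theorem backPointer_lt (u : ℕ) :
    backPointer A M t u < 2 ^ (Nat.log 2 (numBlocks A) + 1) := by
  unfold backPointer
  split_ifs with h
  · exact lt_two_pow_of_lt_numBlocks (Fin.is_lt _)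
  · positivity

/-! ### Query expressions and programs -/

namespace Expr

/-- The image under the block permutation. -/
def image (z : Expr) : Expr := entry (header 9) z (header 3)

/-- Whether the index in register `2` is marked. -/
def marked : Expr :=
  .bin .eq (.bin .eq (compactEntry (header 14) (reg 2))
    (compactEntry (header 14) (.bin .add (reg 2) (const 1)))) (const 0)

/-- The back pointer of the index in register `2`. -/
def back : Expr := entry (header 10) (compactEntry (header 14) (reg 2)) (header 3)

/-- The index of the block of the sorted array that contains the entry counted by register `0`. -/
def sortedBlock : Expr :=
  .bin .sub (rank (header 4) (header 6) (header 8) (reg 0)) (const 1)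

/-- The position of the entry counted by register `0`. -/
def select : Expr :=
  .bin .add (compactEntry (header 11) (image sortedBlock))
    (.bin .sub (.bin .sub (reg 0) (const 1)) (compactEntry (header 12) sortedBlock))

/-- The index of the block that contains the position in register `0`. -/
def block : Expr :=
  .bin .sub (rank (header 4) (header 5) (header 7) (.bin .add (reg 0) (const 1))) (const 1)

/-- The rank of the position in register `0`, which lies in the block with the index in
register `1`, and with the index in register `2` in the sorted array. -/
def rankInBlock : Expr :=
  .bin .add (.bin .div (compactEntry (header 13) (reg 2)) (const 2))
    (.bin .mul (.bin .sub (reg 0) (compactEntry (header 11) (reg 1)))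
      (.bin .sub (const 1) (.bin .mod (compactEntry (header 13) (reg 2)) (const 2))))

end Expr

/-- The program for `select`. -/
def selectProgram : Prog := .assign 0 .select

/-- The program for `rank`. -/
def rankProgram : Prog :=
  .seq (.assign 1 .block)
    (.seq (invert (.image (.reg 2)) .marked .back) (.assign 0 .rankInBlock))

/-- The words are large enough for the data structure. -/
structure FitsWords (w : ℕ) (A : Fin n → α) (M : Finset (Fin (numBlocks A))) (t : ℕ) : Prop where
  four_le : 4 ≤ w
  key_lt : 2 * n + 1 < 2 ^ w
  groupSize_lt : groupSize n < 2 ^ w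
  chunkSize_le : chunkSize n ≤ w
  log_lt : Nat.log 2 (numBlocks A) + 1 ≤ w
  length_lt : (encoding A M t w).length < 2 ^ w

theorem groupSize_pos (n : ℕ) : 0 < groupSize n := by unfold groupSize; positivity

theorem chunkSize_pos (n : ℕ) : 0 < chunkSize n := Nat.succ_pos _

/-! ### Correctness and running time of the queries -/

namespace FitsWords

variable {w : ℕ} {s : Regs}

theorem sixteen_le (H : FitsWords w A M t) : 16 ≤ 2 ^ w :=
  Nat.pow_le_pow_right (n := 2) (by norm_num) H.four_le

theorem two_le (H : FitsWords w A M t) : 2 ≤ w := le_trans (by norm_num) H.four_le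

theorem lt_two_pow (H : FitsWords w A M t) {x : ℕ} (h : x ≤ n) : x < 2 ^ w := by
  have := H.key_lt
  omega

theorem word_zero (_H : FitsWords w A M t) : word w (encoding A M t w) 0 = w := by
  refine word_memory (by simp) ?_
  simpa [memoryHeader, parameters] using Nat.lt_two_pow_self

theorem word_one (H : FitsWords w A M t) : word w (encoding A M t w) 1 = groupSize n := by
  refine word_memory (by simp [segments]) ?_
  simpa [memoryHeader, parameters] using H.groupSize_lt

theorem word_two (H : FitsWords w A M t) : word w (encoding A M t w) 2 = chunkSize n := by
  refine word_memory (by simp [segments]) ?_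
  simpa [memoryHeader, parameters] using H.chunkSize_le.trans_lt Nat.lt_two_pow_self

theorem word_three (H : FitsWords w A M t) :
    word w (encoding A M t w) 3 = Nat.log 2 (numBlocks A) + 1 := by
  refine word_memory (by simp [segments]) ?_
  simpa [memoryHeader, parameters] using H.log_lt.trans_lt Nat.lt_two_pow_self

/-- Header word `4 + k` holds the bit index of segment `k`; this explains the header numbers in the
query expressions, such as `9` for the permutation and `14` for the numbers of marks. -/
theorem occursAt (H : FitsWords w A M t) (k : ℕ) (hk : k < (segments A M t w).length) :
    OccursAt (encoding A M t w) (word w (encoding A M t w) (4 + k)) (segments A M t w)[k] :=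
  memory_occursAt H.length_lt k hk

theorem eval_header (H : FitsWords w A M t) {k : ℕ} (hk : k < 16) :
    (Expr.header k).eval w (encoding A M t w) s = word w (encoding A M t w) k :=
  Expr.eval_header (hk.trans_le H.sixteen_le)

theorem eval_const (H : FitsWords w A M t) {k : ℕ} (hk : k < 16) :
    (Expr.const k).eval w (encoding A M t w) s = k :=
  Expr.eval_const (hk.trans_le H.sixteen_le)

theorem eval_compactEntry (H : FitsWords w A M t) {j m z : ℕ} {a : ℕ → ℕ} (hj : j < 16)
    (hm : Monotone a) (ha : ∀ i, a i ≤ 2 * n + 1)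
    (h : OccursAt (encoding A M t w) (word w (encoding A M t w) j) (compactArray w n a m))
    {i : Expr} (hi : i.eval w (encoding A M t w) s = z) (hz : z ≤ m) :
    (Expr.compactEntry (.header j) i).eval w (encoding A M t w) s = a z :=
  Expr.eval_compactEntry H.two_le H.word_zero H.word_one (groupSize_pos n) H.length_lt hm
    (fun i => (ha i).trans_lt H.key_lt) h (H.eval_header hj) hi
    (Nat.lt_succ_of_le (Nat.div_le_div_right hz))

theorem eval_rank (H : FitsWords w A M t) {j j' k : ℕ} (hj : j < 16) (hj' : j' < 16) {P : ℕ → Prop}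
    [DecidablePred P]
    (hB : OccursAt (encoding A M t w) (word w (encoding A M t w) j) (bitVector n P))
    (hR : OccursAt (encoding A M t w) (word w (encoding A M t w) j')
      (compactArray w n (chunkCount n (chunkSize n) P) (n / chunkSize n)))
    {x : Expr} (hx : x.eval w (encoding A M t w) s = k) (hk : k ≤ n) :
    (Expr.rank (.header 4) (.header j) (.header j') x).eval w (encoding A M t w) s
      = Nat.count P k :=
  Expr.eval_rank H.two_le H.word_zero H.word_one H.word_two (groupSize_pos n) (chunkSize_pos n)
    H.chunkSize_le H.length_lt (H.lt_two_pow le_rfl) (H.occursAt 0 (by simp [segments])) hB hR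
    (H.eval_header (by norm_num)) (H.eval_header hj) (H.eval_header hj') hx hk
    (Nat.lt_succ_of_le (Nat.div_le_div_right (Nat.div_le_div_right hk)))

theorem eval_image (H : FitsWords w A M t) {e : Expr} {z : Fin (numBlocks A)}
    (he : e.eval w (encoding A M t w) s = z.val) :
    (Expr.image e).eval w (encoding A M t w) s = (blockPerm A z).val := by
  have h := Expr.eval_entry H.two_le H.word_zero (H.eval_header (by norm_num)) he
    ((H.eval_header (by norm_num)).trans H.word_three) H.length_lt
    (H.occursAt 5 (by simp [segments])) z.2 (blockImage_lt z.2) H.log_lt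
  rw [Expr.image, h, blockImage, dif_pos z.2]

theorem eval_markCount (H : FitsWords w A M t) {e : Expr} {z : ℕ} (hz : z ≤ numBlocks A)
    (he : e.eval w (encoding A M t w) s = z) :
    (Expr.compactEntry (.header 14) e).eval w (encoding A M t w) s
      = Nat.count (IsMarked A M) z := by
  rw [H.eval_compactEntry (by norm_num) (monotone_count_min _ _)
    (fun i => (count_min_le (IsMarked A M) n i).trans (by omega))
    (H.occursAt 10 (by simp [segments])) he hz, min_eq_left (hz.trans numBlocks_le)]

/-- Marks need no bit vector: a point is marked when the stored count grows at it. The same count is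
the index of its back pointer. -/
theorem eval_marked (H : FitsWords w A M t) [DecidableEq (Fin (numBlocks A))]
    {z : Fin (numBlocks A)} (hz : s 2 = z.val) :
    Expr.marked.eval w (encoding A M t w) s = if z ∈ M then 1 else 0 := by
  have hz2 := z.2
  have e1 := Expr.eval_reg (w := w) (D := encoding A M t w) hz
  have e2 := H.eval_markCount hz2.le e1
  have e3 := H.eval_markCount (show z.val + 1 ≤ numBlocks A from hz2)
    (Expr.eval_add e1 (H.eval_const (by norm_num))
      (H.lt_two_pow (show z.val + 1 ≤ n from le_trans hz2 numBlocks_le)))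
  rw [Expr.marked, Expr.eval_eq (Expr.eval_eq e2 e3) (H.eval_const (by norm_num)), Nat.count_succ]
  have hm : IsMarked A M z.val ↔ z ∈ M := ⟨fun h => h.2, fun h => ⟨hz2, h⟩⟩
  by_cases h : z ∈ M <;> simp [hm, h]

theorem eval_back (H : FitsWords w A M t) {z : Fin (numBlocks A)} (hz : s 2 = z.val) (hM : z ∈ M) :
    Expr.back.eval w (encoding A M t w) s = ((blockPerm A ^ (2 * t)).symm z).val := by
  have hm : IsMarked A M z.val := ⟨z.2, hM⟩
  have hcount : Nat.count (IsMarked A M) z.val < M.card := by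
    rw [← count_isMarked]
    exact Nat.count_strict_mono hm z.2
  have h := Expr.eval_entry H.two_le H.word_zero (H.eval_header (by norm_num))
    (H.eval_markCount z.2.le (Expr.eval_reg hz))
    ((H.eval_header (by norm_num)).trans H.word_three) H.length_lt
    (H.occursAt 6 (by simp [segments])) hcount (backPointer_lt _) H.log_lt
  have hnth := Nat.nth_count hm
  rw [Expr.back, h, backPointer, dif_pos (by rw [hnth]; exact z.2)]
  simp only [hnth]

theorem eval_blockPos (H : FitsWords w A M t) {e : Expr} {b : ℕ} (hb : b < numBlocks A)
    (he : e.eval w (encoding A M t w) s = b) :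
    (Expr.compactEntry (.header 11) e).eval w (encoding A M t w) s
      = Nat.nth (IsBlockStart A) b := by
  rw [H.eval_compactEntry (by norm_num) (monotone_min_nth (infinite_isBlockStart A) n)
    (fun i => (min_le_right _ _).trans (by omega)) (H.occursAt 7 (by simp [segments])) he hb.le,
    min_eq_left (nth_isBlockStart_lt A hb).le]

theorem eval_sortedBlockPos (H : FitsWords w A M t) {e : Expr} {r : ℕ} (hr : r < numBlocks A)
    (he : e.eval w (encoding A M t w) s = r) :
    (Expr.compactEntry (.header 12) e).eval w (encoding A M t w) s
      = Nat.nth (IsSortedBlockStart A) r := by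
  rw [H.eval_compactEntry (by norm_num) (monotone_min_nth (infinite_isSortedBlockStart A) n)
    (fun i => (min_le_right _ _).trans (by omega)) (H.occursAt 8 (by simp [segments])) he hr.le,
    min_eq_left (nth_isSortedBlockStart_lt A hr).le]

theorem eval_blockKey (H : FitsWords w A M t) {e : Expr} {r : ℕ} (hr : r < numBlocks A)
    (he : e.eval w (encoding A M t w) s = r) :
    (Expr.compactEntry (.header 13) e).eval w (encoding A M t w) s = blockKey A r :=
  H.eval_compactEntry (by norm_num) (monotone_blockKey A) (blockKey_le A)
    (H.occursAt 9 (by simp [segments])) he hr.le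

theorem answers_select (H : FitsWords w A M t) (j : Fin n) :
    Answers w (encoding A M t w) selectProgram (j.val + 1) (Tuple.sort A j).val
      (Expr.select.cost + 1) := by
  set s : Regs := fun r => if r = 0 then j.val + 1 else 0 with hs
  refine ⟨_, Runs.assign 0 _ s, ?_⟩
  rw [Function.update_self]
  have hj := j.2
  obtain ⟨r, -, hr, hle, hpos, -⟩ := exists_block A (Tuple.sort A j)
  rw [Equiv.symm_apply_apply] at hr hpos
  have e0 : (Expr.reg 0).eval w (encoding A M t w) s = j.val + 1 := Expr.eval_reg (by simp [hs])
  have one := H.eval_const (s := s) (show 1 < 16 by norm_num)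
  -- Register `0` holds `j + 1`, so the count includes a start at index `j` itself and equals `r +
  -- 1`.
  have e1 := H.eval_rank (by norm_num) (by norm_num) (H.occursAt 2 (by simp [segments]))
    (H.occursAt 4 (by simp [segments])) e0 hj
  have hr2 := r.2
  have hδ := numBlocks_le (A := A)
  have e2 := Expr.eval_sub e1 one (by omega) (H.lt_two_pow ((Nat.count_le _).trans hj))
  rw [hr, Nat.add_sub_cancel] at e2
  have e3 := Expr.eval_sub e0 one (by omega) (H.lt_two_pow hj)
  have e4 := H.eval_sortedBlockPos hr2 e2
  have e5 := Expr.eval_sub e3 e4 (by omega) (H.lt_two_pow (by omega))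
  have e6 := H.eval_blockPos (blockPerm A r).2 (H.eval_image e2)
  rw [nth_blockPerm] at e6
  have hp := (Tuple.sort A j).2
  rw [Expr.select]
  refine (Expr.eval_add e6 e5 (H.lt_two_pow (by omega))).trans (by omega)

theorem answers_rank (H : FitsWords w A M t)
    (hM : ∀ x, ∃ k < 2 * t, (blockPerm A ^ k) x ∈ M ∨ (blockPerm A ^ (k + 1)) x = x) (p : Fin n) :
    ∃ T ≤ (t + 1) * (8 * ((Expr.image (.reg 2)).cost + Expr.marked.cost + Expr.back.cost + 10)
        + Expr.block.cost + Expr.rankInBlock.cost + 2),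
      Answers w (encoding A M t w) rankProgram p.val (rankIn A (A p)) T := by
  classical
  set s : Regs := fun r => if r = 0 then p.val else 0 with hs
  have hp := p.2
  obtain ⟨r, hb, -, hle, -, hrank⟩ := exists_block A p
  have hδ := numBlocks_le (A := A)
  have e1 := H.eval_rank (s := s) (by norm_num) (by norm_num) (H.occursAt 1 (by simp [segments]))
    (H.occursAt 3 (by simp [segments]))
    (Expr.eval_add (Expr.eval_reg (show s 0 = p.val by simp [hs])) (H.eval_const (show 1 < 16 by norm_num))
      (H.lt_two_pow hp)) hp
  have e2 := Expr.eval_sub e1 (H.eval_const (s := s) (show 1 < 16 by norm_num)) (by omega)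
    (H.lt_two_pow ((Nat.count_le _).trans hp))
  rw [hb, Nat.add_sub_cancel] at e2
  have r1 := Runs.assign (w := w) (D := encoding A M t w) 1 Expr.block s
  rw [show Expr.block.eval w (encoding A M t w) s = (blockPerm A r).val from e2] at r1
  obtain ⟨T, hT, r2⟩ := runs_invert (Expr.image (.reg 2)) Expr.marked Expr.back (blockPerm A) M hM
    (fun s z hz => H.eval_image (Expr.eval_reg hz)) (fun s z hz => H.eval_marked hz)
    (fun s z hz hzM => H.eval_back hz hzM) (Function.update s 1 (blockPerm A r).val)
    (blockPerm A r) (Function.update_self _ _ _)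
  rw [Equiv.symm_apply_apply] at r2
  set s' := Function.update (Function.update s 1 (blockPerm A r).val) 2 r.val with hs'
  have f0 := Expr.eval_reg (w := w) (D := encoding A M t w) (show s' 0 = p.val by simp [hs', hs])
  have f1 := Expr.eval_reg (w := w) (D := encoding A M t w)
    (show s' 1 = (blockPerm A r).val by simp [hs'])
  have f2 := Expr.eval_reg (w := w) (D := encoding A M t w) (show s' 2 = r.val by simp [hs'])
  have f3 := H.eval_blockPos (blockPerm A r).2 f1
  rw [nth_blockPerm] at f3
  have f4 := H.eval_blockKey r.2 f2
  have one := H.eval_const (s := s') (show 1 < 16 by norm_num)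
  have two := H.eval_const (s := s') (show 2 < 16 by norm_num)
  have f5 := Expr.eval_sub f0 f3 hle (H.lt_two_pow hp.le)
  have f6 := Expr.eval_sub one (Expr.eval_mod f4 two) (by omega)
    (lt_of_lt_of_le (by norm_num) H.sixteen_le)
  have hrn := rankIn_le (A := A) (A p)
  have f7 := Expr.eval_add (Expr.eval_div f4 two)
    (Expr.eval_mul f5 f6 (H.lt_two_pow (by omega))) (H.lt_two_pow (by omega))
  refine ⟨_, ?_, _, Runs.seq r1 (Runs.seq r2 (Runs.assign 0 Expr.rankInBlock s')), ?_⟩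
  · nlinarith [Nat.zero_le (t * (Expr.block.cost + Expr.rankInBlock.cost + 2))]
  · rw [Function.update_self, hrank]
    exact f7

end FitsWords
end Encoding
end WordRAM

/-! ### Growth of the logarithms -/

section Growth

open Filter Asymptotics

theorem isLittleO_natLog_succ_pow (k : ℕ) :
    (fun n : ℕ => ((Nat.log 2 n + 1 : ℕ) : ℝ) ^ k) =o[atTop] fun n : ℕ => (n : ℝ) := by
  have h1 : (fun n : ℕ => ((Nat.log 2 n + 1 : ℕ) : ℝ)) =O[atTop] fun n : ℕ => Real.log n := by
    refine IsBigO.of_bound (2 / Real.log 2) ?_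
    filter_upwards [eventually_ge_atTop 2] with n hn
    have hl2 : 0 < Real.log 2 := Real.log_pos (by norm_num)
    have hn' : (2 : ℝ) ≤ n := by exact_mod_cast hn
    have hln : Real.log 2 ≤ Real.log n := Real.log_le_log (by norm_num) hn'
    have h := Real.natLog_le_logb n 2
    rw [Nat.cast_ofNat, Real.logb] at h
    have h' : 1 ≤ Real.log n / Real.log 2 := (one_le_div hl2).2 hln
    rw [Real.norm_of_nonneg (by positivity), Real.norm_of_nonneg (hl2.le.trans hln)]
    push_cast
    calc _ ≤ Real.log n / Real.log 2 + Real.log n / Real.log 2 := add_le_add h h'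
      _ = _ := by ring
  exact (h1.pow k).trans_isLittleO
    ((Real.isLittleO_pow_log_id_atTop (n := k)).comp_tendsto tendsto_natCast_atTop_atTop)

theorem tendsto_natLog_succ : Tendsto (fun n : ℕ => Nat.log 2 n + 1) atTop atTop := by
  refine tendsto_atTop.2 fun b => ?_
  filter_upwards [eventually_ge_atTop (2 ^ b)] with n hn
  have := Nat.log_mono_right (b := 2) hn
  rw [Nat.log_pow (by norm_num)] at this
  omega

/-- The width of the fields of short groups of compact arrays. -/
def fieldBound (n : ℕ) : ℕ := 4 * (Nat.log 2 (Nat.log 2 n + 1) + 1)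

/-- The lower order term of the size of the data structure. -/
noncomputable def redundancy (K n : ℕ) : ℝ :=
  100 * (K + 1) * ((n + 1) * (fieldBound n / (Nat.log 2 n + 1 : ℕ))
    + (Real.sqrt n + 1) * ((Nat.log 2 n + 1 : ℕ) : ℝ) ^ 3)

theorem isLittleO_redundancy (K : ℕ) :
    redundancy K =o[atTop] fun n : ℕ => (n : ℝ) := by
  have hO : (fun n : ℕ => (n : ℝ) + 1) =O[atTop] fun n : ℕ => (n : ℝ) := by
    refine IsBigO.of_bound 2 ?_
    filter_upwards [eventually_ge_atTop 1] with n hn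
    have hn' : (1 : ℝ) ≤ n := by exact_mod_cast hn
    rw [Real.norm_of_nonneg (by positivity), Real.norm_of_nonneg (by positivity)]
    linarith
  have h1 : (fun n : ℕ => (fieldBound n / (Nat.log 2 n + 1 : ℕ) : ℝ)) =o[atTop]
      fun _ => (1 : ℝ) := by
    have h := ((isLittleO_natLog_succ_pow 1).comp_tendsto tendsto_natLog_succ).const_mul_left 4
    rw [isLittleO_one_iff]
    refine (isLittleO_iff_tendsto' ?_).1 h |>.congr fun n => ?_
    · refine Eventually.of_forall fun n hn => ?_
      simp only [Function.comp] at hn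
      exact absurd hn (by positivity)
    · simp [fieldBound]
  have h2 : (fun n : ℕ => Real.sqrt n * ((Nat.log 2 n + 1 : ℕ) : ℝ) ^ 3) =o[atTop]
      fun n : ℕ => (n : ℝ) := by
    -- Squaring removes the root and reduces the claim to the sixth power of the logarithm being
    -- `o(n)`.
    refine IsLittleO.of_pow (n := 2) ?_ (by norm_num)
    have h := (isBigO_refl (fun n : ℕ => (n : ℝ)) atTop).mul_isLittleO (isLittleO_natLog_succ_pow 6)
    refine h.congr (fun n => ?_) fun n => ?_
    · rw [Pi.pow_apply, mul_pow, Real.sq_sqrt (by positivity)]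
      ring
    · rw [Pi.pow_apply]; ring
  have h3 := ((hO.mul_isLittleO h1).congr_right fun n => mul_one _).add
    (h2.add (isLittleO_natLog_succ_pow 3))
  refine (h3.const_mul_left (100 * (K + 1) : ℝ)).congr_left fun n => ?_
  rw [redundancy]
  ring

/-- Here `2 ^ 3 ≤ 3 ^ 2` gives `log 3 ≥ 3 / 2`, and `2 ≤ (3 / 2) ^ 2` gives `log (3 / 2) ≥ 1 / 2`.
-/
theorem logb_logb_ge {δ : ℕ} (hδ : 3 ≤ δ) :
    1 ≤ Real.logb 2 δ ∧ 1 / 2 ≤ Real.logb 2 (Real.logb 2 δ) := by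
  have h3 : (3 : ℝ) ≤ δ := by exact_mod_cast hδ
  have h1 : (3 / 2 : ℝ) ≤ Real.logb 2 3 := by
    have : Real.logb 2 (2 ^ 3 : ℝ) ≤ Real.logb 2 (3 ^ 2 : ℝ) :=
      Real.logb_le_logb_of_le (by norm_num) (by norm_num) (by norm_num)
    rw [Real.logb_pow, Real.logb_pow, Real.logb_self_eq_one (by norm_num)] at this
    push_cast at this
    linarith
  have h2 : (1 / 2 : ℝ) ≤ Real.logb 2 (3 / 2) := by
    have : Real.logb 2 (2 : ℝ) ≤ Real.logb 2 ((3 / 2) ^ 2 : ℝ) :=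
      Real.logb_le_logb_of_le (by norm_num) (by norm_num) (by norm_num)
    rw [Real.logb_pow, Real.logb_self_eq_one (by norm_num)] at this
    push_cast at this
    linarith
  have h4 := Real.logb_le_logb_of_le (b := 2) (by norm_num) (by norm_num) h3
  refine ⟨by linarith, h2.trans ?_⟩
  exact Real.logb_le_logb_of_le (by norm_num) (by norm_num) (h1.trans h4)

theorem logb_logb_nonneg (δ : ℕ) : 0 ≤ Real.logb 2 (Real.logb 2 δ) := by
  rcases lt_or_ge δ 3 with h | h
  · interval_cases δ <;> simp
  · linarith [(logb_logb_ge h).2]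

/-- If `δ < √n + 2`, the last term suffices. Otherwise `n ≤ δ²`, so `log n` is at most a constant
times `log δ`, and the iterated logarithms differ by at most a constant; it is absorbed because `log
log δ ≥ 1 / 2` for `δ ≥ 3`. -/
theorem mul_fieldBound_le (n δ : ℕ) :
    (δ : ℝ) * fieldBound n ≤ 28 * (δ * Real.logb 2 (Real.logb 2 δ))
      + (Real.sqrt n + 2) * fieldBound n := by
  have hL := logb_logb_nonneg δ
  have hs := Real.sqrt_nonneg n
  rcases lt_or_ge (δ : ℝ) (Real.sqrt n + 2) with h | h
  · have : (δ : ℝ) * fieldBound n ≤ (Real.sqrt n + 2) * fieldBound n :=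
      mul_le_mul_of_nonneg_right h.le (by positivity)
    have : 0 ≤ 28 * (δ * Real.logb 2 (Real.logb 2 δ)) := by positivity
    linarith
  · rcases lt_or_ge δ 3 with h3 | h3
    · have h2 : (δ : ℝ) ≤ 2 := by exact_mod_cast Nat.lt_succ_iff.1 h3
      have : (δ : ℝ) * fieldBound n ≤ (Real.sqrt n + 2) * fieldBound n :=
        mul_le_mul_of_nonneg_right (by linarith) (by positivity)
      have : 0 ≤ 28 * (δ * Real.logb 2 (Real.logb 2 δ)) := by positivity
      linarith
    obtain ⟨h1, h2⟩ := logb_logb_ge h3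
    have hδ : (3 : ℝ) ≤ δ := by exact_mod_cast h3
    have hl : ((Nat.log 2 n + 1 : ℕ) : ℝ) ≤ 4 * Real.logb 2 δ := by
      rcases Nat.eq_zero_or_pos n with rfl | hn
      · simp; linarith
      have hn' : (0 : ℝ) < n := by exact_mod_cast hn
      have h4 := Real.natLog_le_logb n 2
      have h5 : (n : ℝ) ≤ (δ : ℝ) ^ 2 := by
        calc (n : ℝ) = Real.sqrt n ^ 2 := (Real.sq_sqrt hn'.le).symm
          _ ≤ _ := pow_le_pow_left₀ hs (by linarith) 2
      have h6 := Real.logb_le_logb_of_le (b := 2) (by norm_num) hn' h5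
      rw [Real.logb_pow] at h6
      push_cast at h4 h6 ⊢
      linarith
    have hl2 : (Nat.log 2 (Nat.log 2 n + 1) : ℝ) ≤ 2 + Real.logb 2 (Real.logb 2 δ) := by
      have h4 := Real.natLog_le_logb (Nat.log 2 n + 1) 2
      have h5 := Real.logb_le_logb_of_le (b := 2) (by norm_num) (by positivity) hl
      rw [Real.logb_mul (by norm_num) (by linarith), show (4 : ℝ) = 2 ^ 2 by norm_num,
        Real.logb_pow, Real.logb_self_eq_one (by norm_num)] at h5
      push_cast at h4 h5
      linarith
    -- `4 (2 + x + 1) = 12 + 4x ≤ 28x` for `x ≥ 1 / 2`.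
    have hf : (fieldBound n : ℝ) ≤ 28 * Real.logb 2 (Real.logb 2 δ) := by
      rw [fieldBound]
      push_cast
      linarith
    have : (δ : ℝ) * fieldBound n ≤ δ * (28 * Real.logb 2 (Real.logb 2 δ)) :=
      mul_le_mul_of_nonneg_left hf (by positivity)
    have : 0 ≤ (Real.sqrt n + 2) * fieldBound n := by positivity
    linarith

/-- The distance of marked indices on the cycles of the block permutation. -/
def markDistance (δ : ℕ) : ℕ := Nat.log 2 δ / (Nat.log 2 (Nat.log 2 δ) + 1) + 1

theorem markDistance_le (δ : ℕ) :
    (markDistance δ + 1 : ℝ) ≤ 3 * (1 + Real.logb 2 δ / Real.logb 2 (Real.logb 2 δ)) := by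
  rcases lt_or_ge δ 3 with h | h
  -- For `δ ≤ 2` the iterated logarithm is `0`, the quotient is `0` by convention, and the bound is
  -- `3`.
  · interval_cases δ <;> norm_num [markDistance]
  · obtain ⟨h1, h2⟩ := logb_logb_ge h
    have h3 : Real.logb 2 (Real.logb 2 δ) ≤ (Nat.log 2 (Nat.log 2 δ) + 1 : ℕ) := by
      have h4 : Nat.log 2 δ + 1 ≤ 2 ^ (Nat.log 2 (Nat.log 2 δ) + 1) :=
        Nat.lt_pow_succ_log_self (by norm_num) _
      have h5 : Real.logb 2 δ ≤ ((2 : ℝ) ^ (Nat.log 2 (Nat.log 2 δ) + 1)) := by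
        have h6 : δ ≤ 2 ^ (Nat.log 2 δ + 1) := (Nat.lt_pow_succ_log_self (by norm_num) _).le
        have h7 : (δ : ℝ) ≤ 2 ^ (Nat.log 2 δ + 1) := by exact_mod_cast h6
        have h8 := Real.logb_le_logb_of_le (b := 2) (by norm_num)
          (by exact_mod_cast (by omega : 0 < δ)) h7
        rw [Real.logb_pow, Real.logb_self_eq_one (by norm_num), mul_one] at h8
        exact h8.trans (by exact_mod_cast h4)
      have h6 := Real.logb_le_logb_of_le (b := 2) (by norm_num) (by linarith) h5
      rwa [Real.logb_pow, Real.logb_self_eq_one (by norm_num), mul_one] at h6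
    have h4 : ((Nat.log 2 δ / (Nat.log 2 (Nat.log 2 δ) + 1) : ℕ) : ℝ)
        ≤ Real.logb 2 δ / Real.logb 2 (Real.logb 2 δ) := by
      refine Nat.cast_div_le.trans ?_
      exact div_le_div₀ (by linarith) (Real.natLog_le_logb δ 2) (by linarith) h3
    have h5 : 0 ≤ Real.logb 2 δ / Real.logb 2 (Real.logb 2 δ) := div_nonneg (by linarith) (by linarith)
    rw [markDistance]
    push_cast at h4 ⊢
    linarith

/-- The spacing of the marks is chosen so that all back pointers together take `O(log log δ)` bits
per block. -/
theorem card_mul_le_of_mul_markDistance_le {δ m : ℕ} (h : m * markDistance δ ≤ δ) :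
    m * (Nat.log 2 δ + 1) ≤ δ * (Nat.log 2 (Nat.log 2 δ) + 1) := by
  have h1 : Nat.log 2 δ + 1 ≤ (Nat.log 2 (Nat.log 2 δ) + 1) * markDistance δ :=
    Nat.lt_mul_div_succ _ (Nat.succ_pos _)
  calc _ ≤ m * ((Nat.log 2 (Nat.log 2 δ) + 1) * markDistance δ) := Nat.mul_le_mul_left m h1
    _ = m * markDistance δ * (Nat.log 2 (Nat.log 2 δ) + 1) := by ring
    _ ≤ _ := Nat.mul_le_mul_right _ h

end Growth

namespace WordRAM

/-! ### The size of the data structure -/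

theorem length_compactArray_le_mul {w n : ℕ} {a : ℕ → ℕ} (ha : ∀ i, a i < 2 ^ w) {m : ℕ}
    (hm : m ≤ n) :
    (compactArray w n a m).length ≤ (n + 1) * (3 + groupSize n) * w := by
  refine (length_compact_le ha _ _).trans ?_
  gcongr
  exact (Nat.div_le_self _ _).trans hm

/-- With `ℓ = Nat.log 2 n + 1`, groups of `ℓ²` entries and threshold `ℓ⁴`, the directory takes `O(K
n / ℓ)` bits up to one extra group, and so do the wide groups: `ℓ² w (2n + 1) / ℓ⁴` with `w ≤ K ℓ`.
-/
theorem length_compactArray_le {w n K : ℕ} (hw : 2 * n + 1 < 2 ^ w)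
    (hK : w ≤ K * (Nat.log 2 n + 1)) {a : ℕ → ℕ} (hmono : Monotone a) (ha : ∀ i, a i ≤ 2 * n + 1)
    {m : ℕ} (hm : m ≤ n) :
    ((compactArray w n a m).length : ℝ) ≤ m * fieldBound n
      + (5 * K * ((n + 1) / (Nat.log 2 n + 1 : ℕ)) + 3 * K * (Nat.log 2 n + 1 : ℕ)
        + (Nat.log 2 n + 1 : ℕ) ^ 2 * fieldBound n) := by
  have h4 : (Nat.log 2 n + 1) ^ 4 ≤ 2 ^ fieldBound n := by
    rw [fieldBound, mul_comm, pow_mul]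
    exact Nat.pow_le_pow_left (Nat.lt_pow_succ_log_self (by norm_num) _).le 4
  have h := length_compact_mul_le hmono (fun i => (ha i).trans_lt hw) (groupSize n)
    (m / groupSize n + 1) ha h4
  change (compactArray w n a m).length * _ ≤ _ at h
  have hdiv : m / groupSize n * groupSize n ≤ m := Nat.div_mul_le_self _ _
  have hG : (m / groupSize n + 1) * groupSize n ≤ m + groupSize n := by
    rw [Nat.succ_mul]; omega
  rw [groupSize] at *
  generalize m / (Nat.log 2 n + 1) ^ 2 = g at *
  generalize (compactArray w n a m).length = len at *
  generalize fieldBound n = f at *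
  have hl : 0 < Nat.log 2 n + 1 := Nat.succ_pos _
  generalize Nat.log 2 n + 1 = l at *
  have hlr : (0 : ℝ) < l := by exact_mod_cast hl
  have h' : (len : ℝ) * l ^ 4 ≤ ((g + 1) * 3 * w + (g + 1) * l ^ 2 * f) * l ^ 4
      + l ^ 2 * w * (2 * n + 1) := by exact_mod_cast h
  have hG' : ((g : ℝ) + 1) * l ^ 2 ≤ m + l ^ 2 := by exact_mod_cast hG
  have hdiv' : (g : ℝ) * l ^ 2 ≤ n := by exact_mod_cast hdiv.trans hm
  have hK' : (w : ℝ) ≤ K * l := by exact_mod_cast hK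
  have h1 : (len : ℝ) ≤ (g + 1) * 3 * w + (g + 1) * l ^ 2 * f + w * (2 * n + 1) / l ^ 2 := by
    have h2 : (len : ℝ) * l ^ 4
        ≤ ((g + 1) * 3 * w + (g + 1) * l ^ 2 * f + w * (2 * n + 1) / l ^ 2) * l ^ 4 := by
      refine h'.trans (le_of_eq ?_)
      field_simp
    exact le_of_mul_le_mul_right h2 (by positivity)
  have h2 : ((g : ℝ) + 1) * l ^ 2 * f ≤ (m + l ^ 2) * f :=
    mul_le_mul_of_nonneg_right hG' (by positivity)
  have h3 : (w : ℝ) * (2 * n + 1) / l ^ 2 ≤ 2 * K * ((n + 1) / l) := by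
    calc (w : ℝ) * (2 * n + 1) / l ^ 2 ≤ K * l * (2 * (n + 1)) / l ^ 2 := by
          gcongr
          linarith
      _ = _ := by field_simp
  have h5 : ((g : ℝ) + 1) * 3 * w ≤ 3 * K * ((n + 1) / l) + 3 * K * l := by
    have hg : (g : ℝ) * l ≤ (n + 1) / l := by
      rw [le_div_iff₀ hlr]
      nlinarith
    calc ((g : ℝ) + 1) * 3 * w ≤ (g + 1) * 3 * (K * l) := by gcongr
      _ = 3 * K * (g * l) + 3 * K * l := by ring
      _ ≤ _ := by gcongr
  have h6 : 5 * (K : ℝ) * ((n + 1) / l) = 3 * K * ((n + 1) / l) + 2 * K * ((n + 1) / l) := by ring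
  have h7 : ((m : ℝ) + l ^ 2) * f = m * f + l ^ 2 * f := by ring
  linarith

/-! ### Total length of the encoding -/

section Size

variable {α : Type*} [LinearOrder α] {n : ℕ} (A : Fin n → α) (M : Finset (Fin (numBlocks A)))
  (t w : ℕ)

theorem length_encoding : (encoding A M t w).length
    = 15 * w + 2 ^ chunkSize n * w + 2 * n
      + (compactArray w n (chunkCount n (chunkSize n) (IsBlockStart A)) (n / chunkSize n)).length
      + (compactArray w n (chunkCount n (chunkSize n) (IsSortedBlockStart A))
          (n / chunkSize n)).length
      + numBlocks A * (Nat.log 2 (numBlocks A) + 1) + M.card * (Nat.log 2 (numBlocks A) + 1)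
      + (compactArray w n (fun r => min (Nat.nth (IsBlockStart A) r) n) (numBlocks A)).length
      + (compactArray w n (fun r => min (Nat.nth (IsSortedBlockStart A) r) n)
          (numBlocks A)).length
      + (compactArray w n (blockKey A) (numBlocks A)).length
      + (compactArray w n (fun z => Nat.count (IsMarked A M) (min z n)) (numBlocks A)).length := by
  rw [encoding, length_memory]
  simp only [segments, List.length_cons, List.length_nil, List.flatten_cons, List.flatten_nil,
    List.length_append, length_packed, length_bitVector]
  ring

variable {w}

/-- Needed so that every bit address fits into a word. With `X = 2 ^ (Nat.log 2 n + 1)` the length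
is at most `w X ^ 9`; the factor `20` makes `X ^ 9` fit into the half of the exponent left by `w < 2
^ (w / 2)`. -/
theorem length_encoding_lt (hw : 20 * (Nat.log 2 n + 1) ≤ w) (hkey : 2 * n + 1 < 2 ^ w) :
    (encoding A M t w).length < 2 ^ w := by
  have hn : n < 2 ^ (Nat.log 2 n + 1) := Nat.lt_pow_succ_log_self (by norm_num) n
  have hl : Nat.log 2 n + 1 < 2 ^ (Nat.log 2 n + 1) := Nat.lt_two_pow_self
  have hδ := numBlocks_le (A := A)
  have hM : M.card ≤ numBlocks A := by simpa using M.card_le_univ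
  have hb : Nat.log 2 (numBlocks A) + 1 ≤ w := by
    have := Nat.log_mono_right (b := 2) hδ
    omega
  have hc : 2 ^ chunkSize n ≤ 2 ^ (Nat.log 2 n + 1) :=
    Nat.pow_le_pow_right (by norm_num) (by unfold chunkSize; omega)
  have hq : n / chunkSize n ≤ n := Nat.div_le_self _ _
  have hlt : ∀ {x}, x ≤ 2 * n + 1 → x < 2 ^ w := fun h => h.trans_lt hkey
  have c1 := length_compactArray_le_mul (w := w) (a := chunkCount n (chunkSize n) (IsBlockStart A))
    (fun i => hlt ((chunkCount_le _ _ _ i).trans (by omega))) hq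
  have c2 := length_compactArray_le_mul (w := w)
    (a := chunkCount n (chunkSize n) (IsSortedBlockStart A))
    (fun i => hlt ((chunkCount_le _ _ _ i).trans (by omega))) hq
  have c3 := length_compactArray_le_mul (w := w)
    (a := fun r => min (Nat.nth (IsBlockStart A) r) n)
    (fun i => hlt ((min_le_right _ _).trans (by omega))) hδ
  have c4 := length_compactArray_le_mul (w := w)
    (a := fun r => min (Nat.nth (IsSortedBlockStart A) r) n)
    (fun i => hlt ((min_le_right _ _).trans (by omega))) hδ
  have c5 := length_compactArray_le_mul (w := w) (a := blockKey A)
    (fun i => hlt (blockKey_le A i)) hδ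
  have c6 := length_compactArray_le_mul (w := w)
    (a := fun z => Nat.count (IsMarked A M) (min z n))
    (fun i => hlt ((count_min_le _ _ i).trans (by omega))) hδ
  have c7 : numBlocks A * (Nat.log 2 (numBlocks A) + 1) ≤ n * w := Nat.mul_le_mul hδ hb
  have c8 : M.card * (Nat.log 2 (numBlocks A) + 1) ≤ n * w := Nat.mul_le_mul (hM.trans hδ) hb
  have c9 := Nat.mul_le_mul_right w hc
  have hw1 : 1 ≤ w := by omega
  rw [length_encoding]
  have hX2 : 2 ≤ 2 ^ (Nat.log 2 n + 1) := by
    simpa using Nat.pow_le_pow_right (n := 2) (by norm_num) (show 1 ≤ Nat.log 2 n + 1 by omega)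
  have hbig : w * (2 ^ (Nat.log 2 n + 1)) ^ 9 < 2 ^ w := by
    have hv : ∀ v, 3 ≤ v → 2 * v + 1 < 2 ^ v := fun v hv => by
      induction v, hv using Nat.le_induction with
      | base => norm_num
      | succ v _ ih => rw [pow_succ]; omega
    have h1 : w < 2 ^ (w / 2) := lt_of_le_of_lt (by omega) (hv (w / 2) (by omega))
    calc w * (2 ^ (Nat.log 2 n + 1)) ^ 9
        < 2 ^ (w / 2) * (2 ^ (Nat.log 2 n + 1)) ^ 9 := Nat.mul_lt_mul_of_pos_right h1 (by positivity)
      _ = 2 ^ (w / 2 + (Nat.log 2 n + 1) * 9) := by rw [← pow_mul, ← pow_add]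
      _ ≤ 2 ^ w := Nat.pow_le_pow_right (by norm_num) (by omega)
  refine lt_of_le_of_lt ?_ hbig
  have hgs : (n + 1) * (3 + groupSize n) ≤ 4 * (2 ^ (Nat.log 2 n + 1)) ^ 3 := by
    rw [groupSize]
    calc _ ≤ 2 ^ (Nat.log 2 n + 1) * (3 * (2 ^ (Nat.log 2 n + 1)) ^ 2
          + (2 ^ (Nat.log 2 n + 1)) ^ 2) := by
          gcongr
          · exact hn
          · nlinarith
      _ = _ := by ring
  have hgs' := Nat.mul_le_mul_right w hgs
  have hnw : n * w ≤ 2 ^ (Nat.log 2 n + 1) * w := Nat.mul_le_mul_right w hn.le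
  have hn1 : n ≤ n * w := Nat.le_mul_of_pos_right n hw1
  generalize 2 ^ (Nat.log 2 n + 1) = X at *
  have hX3 : X ≤ X ^ 3 := Nat.le_self_pow (by norm_num) X
  have h8 : 8 ≤ X ^ 3 := by
    calc 8 = 2 ^ 3 := by norm_num
      _ ≤ _ := Nat.pow_le_pow_left hX2 3
  have h64 : 64 * X ^ 3 ≤ X ^ 9 := by
    calc 64 * X ^ 3 = 8 * 8 * X ^ 3 := by ring
      _ ≤ X ^ 3 * X ^ 3 * X ^ 3 := by gcongr
      _ = _ := by ring
  have d1 := Nat.mul_le_mul_right w hX3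
  have d2 := Nat.mul_le_mul_right w h8
  have d3 := Nat.mul_le_mul_right w h64
  have d4 : 64 * X ^ 3 * w = 64 * (X ^ 3 * w) := by ring
  have d5 : 4 * X ^ 3 * w = 4 * (X ^ 3 * w) := by ring
  rw [mul_comm w (X ^ 9)]
  omega

theorem fitsWords (hw : 20 * (Nat.log 2 n + 1) ≤ w) : FitsWords w A M t := by
  have hn : n < 2 ^ (Nat.log 2 n + 1) := Nat.lt_pow_succ_log_self (by norm_num) n
  have hl : Nat.log 2 n + 1 < 2 ^ (Nat.log 2 n + 1) := Nat.lt_two_pow_self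
  have hkey : 2 * n + 1 < 2 ^ w := by
    have : 2 ^ (Nat.log 2 n + 1 + 1) ≤ 2 ^ w := Nat.pow_le_pow_right (by norm_num) (by omega)
    rw [pow_succ] at this
    omega
  have hlog := Nat.log_mono_right (b := 2) (numBlocks_le (A := A))
  refine ⟨by omega, hkey, ?_, by unfold chunkSize; omega, by omega,
    length_encoding_lt A M t hw hkey⟩
  calc groupSize n < (2 ^ (Nat.log 2 n + 1)) ^ 2 := Nat.pow_lt_pow_left hl (by norm_num)
    _ = 2 ^ ((Nat.log 2 n + 1) * 2) := by rw [pow_mul]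
    _ ≤ 2 ^ w := Nat.pow_le_pow_right (by norm_num) (by omega)

set_option maxHeartbeats 1000000 in
theorem length_encoding_le {K : ℕ} (hw : 20 * (Nat.log 2 n + 1) ≤ w)
    (hK : w ≤ K * (Nat.log 2 n + 1)) (hM : M.card * markDistance (numBlocks A) ≤ numBlocks A) :
    ((encoding A M t w).length : ℝ) ≤ numBlocks A * Real.logb 2 (numBlocks A) + 2 * n
      + 168 * (numBlocks A * Real.logb 2 (Real.logb 2 (numBlocks A))) + redundancy K n := by
  have hkey := (fitsWords A M t hw).key_lt
  have hδ := numBlocks_le (A := A)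
  have hq : n / chunkSize n ≤ n := Nat.div_le_self _ _
  have c1 := length_compactArray_le hkey hK (monotone_chunkCount n (chunkSize n) (IsBlockStart A))
    (fun i => (chunkCount_le _ _ _ i).trans (by omega)) hq
  have c2 := length_compactArray_le hkey hK
    (monotone_chunkCount n (chunkSize n) (IsSortedBlockStart A))
    (fun i => (chunkCount_le _ _ _ i).trans (by omega)) hq
  have c3 := length_compactArray_le hkey hK (monotone_min_nth (infinite_isBlockStart A) n)
    (fun i => (min_le_right _ _).trans (by omega)) hδ
  have c4 := length_compactArray_le hkey hK (monotone_min_nth (infinite_isSortedBlockStart A) n)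
    (fun i => (min_le_right _ _).trans (by omega)) hδ
  have c5 := length_compactArray_le hkey hK (monotone_blockKey A) (blockKey_le A) hδ
  have c6 := length_compactArray_le hkey hK (monotone_count_min (IsMarked A M) n)
    (fun i => (count_min_le _ _ i).trans (by omega)) hδ
  have hf4 : (4 : ℝ) ≤ fieldBound n := by
    have : 4 ≤ fieldBound n := by unfold fieldBound; omega
    exact_mod_cast this
  have c7 : ((numBlocks A * (Nat.log 2 (numBlocks A) + 1) : ℕ) : ℝ)
      ≤ numBlocks A * Real.logb 2 (numBlocks A) + numBlocks A * fieldBound n := by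
    push_cast
    rw [← mul_add]
    have := Real.natLog_le_logb (numBlocks A) 2
    rw [Nat.cast_ofNat] at this
    gcongr
    linarith
  have c8 : ((M.card * (Nat.log 2 (numBlocks A) + 1) : ℕ) : ℝ) ≤ numBlocks A * fieldBound n := by
    have h1 := card_mul_le_of_mul_markDistance_le hM
    have h2 : Nat.log 2 (Nat.log 2 (numBlocks A)) + 1 ≤ fieldBound n := by
      have : Nat.log 2 (Nat.log 2 (numBlocks A)) ≤ Nat.log 2 (Nat.log 2 n + 1) :=
        Nat.log_mono_right ((Nat.log_mono_right hδ).trans (Nat.le_succ _))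
      unfold fieldBound
      omega
    exact_mod_cast h1.trans (Nat.mul_le_mul_left _ h2)
  have c9 : (2 : ℝ) ^ chunkSize n ≤ 2 * (Real.sqrt n + 1) := by
    rw [chunkSize, pow_succ]
    have h1 : (2 : ℝ) ^ (Nat.log 2 n / 2) ≤ Real.sqrt n + 1 := by
      rcases Nat.eq_zero_or_pos n with rfl | hn
      · simp
      have h2 : (2 ^ (Nat.log 2 n / 2)) ^ 2 ≤ n := by
        rw [← pow_mul]
        exact (Nat.pow_le_pow_right (by norm_num) (Nat.div_mul_le_self _ _)).trans
          (Nat.pow_log_le_self 2 hn.ne')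
      have h3 : (2 : ℝ) ^ (Nat.log 2 n / 2) ≤ Real.sqrt n :=
        Real.le_sqrt_of_sq_le (by exact_mod_cast h2)
      linarith
    linarith
  have c10 : ((n / chunkSize n : ℕ) : ℝ) * fieldBound n
      ≤ 2 * ((n + 1) * (fieldBound n / (Nat.log 2 n + 1 : ℕ))) := by
    have h1 : n / chunkSize n * (Nat.log 2 n + 1) ≤ 2 * (n + 1) := by
      calc n / chunkSize n * (Nat.log 2 n + 1) ≤ n / chunkSize n * (2 * chunkSize n) := by
            gcongr
            unfold chunkSize
            omega
        _ = 2 * (n / chunkSize n * chunkSize n) := by ring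
        _ ≤ 2 * (n + 1) := by
            have := Nat.div_mul_le_self n (chunkSize n)
            omega
    have h2 : ((n / chunkSize n : ℕ) : ℝ) ≤ 2 * (n + 1) / (Nat.log 2 n + 1 : ℕ) := by
      rw [le_div_iff₀ (by positivity)]
      exact_mod_cast h1
    calc _ ≤ 2 * (n + 1) / (Nat.log 2 n + 1 : ℕ) * (fieldBound n : ℝ) := by gcongr
      _ = _ := by ring
  -- The term `δ * fieldBound n` arises six times: from rounding up `log δ`, from the back pointers,
  -- and from the four compact arrays indexed by blocks. Hence `168 = 6 * 28`.
  have c11 := mul_fieldBound_le n (numBlocks A)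
  have hlen : ((encoding A M t w).length : ℝ) = _ := congrArg Nat.cast (length_encoding A M t w)
  push_cast at hlen c7 c8 c10
  have hfl : (fieldBound n : ℝ) ≤ 4 * (Nat.log 2 n + 1 : ℕ) := by
    have : Nat.log 2 (Nat.log 2 n + 1) < Nat.log 2 n + 1 := Nat.log_lt_self 2 (by omega)
    have : fieldBound n ≤ 4 * (Nat.log 2 n + 1) := by unfold fieldBound; omega
    exact_mod_cast this
  have hl1 : (1 : ℝ) ≤ (Nat.log 2 n + 1 : ℕ) := by exact_mod_cast Nat.succ_pos _
  have hwK : (w : ℝ) ≤ K * (Nat.log 2 n + 1 : ℕ) := by exact_mod_cast hK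
  have hs := Real.sqrt_nonneg n
  rw [redundancy]
  push_cast at *
  generalize (Nat.log 2 n : ℝ) + 1 = l at *
  generalize (fieldBound n : ℝ) = f at *
  generalize Real.sqrt n = r at *
  set X : ℝ := (n + 1) * (f / l) with hX
  set Y : ℝ := (r + 1) * l ^ 3 with hY
  have l1 : l ≤ l ^ 2 := by nlinarith
  have l2 : l ^ 2 ≤ l ^ 3 := by nlinarith [sq_nonneg l]
  have y1 : l ^ 3 ≤ Y := by
    have : 0 ≤ r * l ^ 3 := by positivity
    linarith
  have y2 : (r + 1) * l ≤ Y := mul_le_mul_of_nonneg_left (l1.trans l2) (by positivity)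
  have x1 : (n + 1) / l ≤ X := by
    rw [hX, mul_div_assoc', div_le_div_iff_of_pos_right (by linarith)]
    exact le_mul_of_one_le_right (by positivity) (by linarith)
  have e1 : 15 * (w : ℝ) ≤ 15 * (K * Y) := by
    have : (w : ℝ) ≤ K * Y := hwK.trans (by gcongr; linarith)
    linarith
  have e2 : 2 ^ chunkSize n * (w : ℝ) ≤ 2 * (K * Y) := by
    calc 2 ^ chunkSize n * (w : ℝ) ≤ 2 * (r + 1) * (K * l) := by gcongr
      _ = 2 * (K * ((r + 1) * l)) := by ring
      _ ≤ _ := by gcongr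
  have e3 : 5 * K * ((n + 1) / l) + 3 * K * l + l ^ 2 * f ≤ 5 * (K * X) + 3 * (K * Y) + 4 * Y := by
    have h1 : (K : ℝ) * ((n + 1) / l) ≤ K * X := by gcongr
    have h2 : (K : ℝ) * l ≤ K * Y := by gcongr; linarith
    have h3 : l ^ 2 * f ≤ l ^ 2 * (4 * l) := by gcongr
    have h4 : l ^ 2 * (4 * l) = 4 * l ^ 3 := by ring
    linarith
  have e4 : (r + 2) * f ≤ 8 * Y := by
    calc (r + 2) * f ≤ (2 * (r + 1)) * (4 * l) := by
          gcongr
          linarith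
      _ = 8 * ((r + 1) * l) := by ring
      _ ≤ _ := by gcongr
  have hX0 : 0 ≤ X := le_trans (by positivity) x1
  have hY0 : 0 ≤ Y := le_trans (by positivity) y1
  have hKX : 0 ≤ (K : ℝ) * X := by positivity
  have hKY : 0 ≤ (K : ℝ) * Y := by positivity
  have hfin : 100 * ((K : ℝ) + 1) * (X + Y) = 100 * (K * X) + 100 * (K * Y) + 100 * X + 100 * Y := by
    ring
  linarith

end Size

end WordRAM

/-! ### Assembly -/

theorem mainTheorem9 :
    ∃ (κ : ℕ) (selectProg rankProg : WordRAM.Prog) (C : ℝ),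
      ∀ K : ℕ, ∃ f : ℕ → ℝ, Asymptotics.IsLittleO Filter.atTop f (fun n : ℕ => (n : ℝ)) ∧
        ∀ n w : ℕ, κ * (Nat.log 2 n + 1) ≤ w → w ≤ K * (Nat.log 2 n + 1) →
        ∀ (α : Type*) [LinearOrder α] (A : Fin n → α) (ρ δ : ℕ),
          numRuns A = ρ → numBlocks A = δ →
          ∃ D : List Bool,
            (D.length : ℝ) ≤ δ * Real.logb 2 δ + 2 * n
                + C * (δ * Real.logb 2 (Real.logb 2 δ)) + f n ∧
            (∀ j : Fin n, ∃ (p : Fin n) (t : ℕ),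
              WordRAM.Answers w D selectProg (j.val + 1) p.val t ∧
              A p = selectIn A j ∧ (t : ℝ) ≤ C) ∧
            (∀ p : Fin n, ∃ t : ℕ,
              WordRAM.Answers w D rankProg p.val (rankIn A (A p)) t ∧
              (t : ℝ) ≤ C * (1 + Real.logb 2 δ / Real.logb 2 (Real.logb 2 δ))) := by
  obtain ⟨R, hR⟩ : ∃ R : ℕ, R = 8 * ((WordRAM.Expr.image (.reg 2)).cost + WordRAM.Expr.marked.cost
    + WordRAM.Expr.back.cost + 10) + WordRAM.Expr.block.cost + WordRAM.Expr.rankInBlock.cost + 2 := ⟨_, rfl⟩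
  -- One constant dominates the three that are needed: `168` for the space, the cost of select, and
  -- `3 * R` for rank, where `3` comes from `markDistance_le`.
  refine ⟨20, WordRAM.selectProgram, WordRAM.rankProgram, 168 + (WordRAM.Expr.select.cost + 1 : ℕ) + 3 * R, fun K =>
    ⟨redundancy K, isLittleO_redundancy K, ?_⟩⟩
  rintro n w hw hK α _ A _ _ - rfl
  obtain ⟨M, hM, hreach⟩ := (blockPerm A).exists_marks (t := markDistance (numBlocks A))
    (Nat.succ_pos _)
  have H := WordRAM.fitsWords A M (markDistance (numBlocks A)) hw
  refine ⟨WordRAM.encoding A M (markDistance (numBlocks A)) w, ?_, fun j => ?_, fun p => ?_⟩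
  · refine (WordRAM.length_encoding_le A M _ hw hK hM).trans ?_
    have := logb_logb_nonneg (numBlocks A)
    gcongr
    linarith [Nat.cast_nonneg (α := ℝ) (WordRAM.Expr.select.cost + 1), Nat.cast_nonneg (α := ℝ) R]
  · refine ⟨Tuple.sort A j, _, H.answers_select j, rfl, ?_⟩
    linarith [Nat.cast_nonneg (α := ℝ) R]
  · obtain ⟨T, hT, hans⟩ := H.answers_rank hreach p
    rw [← hR] at hT
    refine ⟨T, hans, ?_⟩
    have h1 : (T : ℝ) ≤ (markDistance (numBlocks A) + 1) * R := by exact_mod_cast hT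
    have h2 := markDistance_le (numBlocks A)
    have h3 : 0 ≤ 1 + Real.logb 2 (numBlocks A) / Real.logb 2 (Real.logb 2 (numBlocks A)) := by
      have : (0 : ℝ) ≤ markDistance (numBlocks A) := Nat.cast_nonneg _
      linarith
    calc (T : ℝ) ≤ (markDistance (numBlocks A) + 1) * R := h1
      _ ≤ 3 * (1 + Real.logb 2 (numBlocks A) / Real.logb 2 (Real.logb 2 (numBlocks A))) * R := by
          gcongr
      _ = 3 * R * (1 + Real.logb 2 (numBlocks A) / Real.logb 2 (Real.logb 2 (numBlocks A))) := by
          ring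
      _ ≤ _ := by
          gcongr
          linarith [Nat.cast_nonneg (α := ℝ) (WordRAM.Expr.select.cost + 1)]
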